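/- **Setting.** Let $T>0$, $\sigma>0$, $\beta\ge 0$, $V=[-10,10]$ and $K=[0,T]\times[-1,1]\times V$. For a multi-index $m\in\mathbb Z_+^3$, write $F\in\widehat C^{m}(K)$ if there is an open set $\Omega\supset K$ such that all partial derivatives $D^kF$ with $k\le m$ (componentwise) exist and are continuous on $\Omega$. For $x\in\{-1,1\}$ let $V_x^-=\{v\in V: xv<0\}$ be the set of incoming velocities at $x$. Let $f_0(x,v)$ be given initial data, and let $f(t,x,v)$ satisfy $$\partial_t f+v\,\partial_x f=\partial_v(\sigma\,\partial_v f+\beta v f)\quad\text{for } (t,x,v)\in(0,T)\times(-1,1)\times V,\qquad f(0,x,v)=f_0(x,v)\quad\text{for }(x,v)\in(-1,1)\times V,$$ and one of the following two boundary conditions for $t\in(0,T)$, $x\in\{-1,1\}$, $v\in V_x^-$: inflow, $f(t,x,v)=g(t,x,v)$ with a given function $g$; or specular reflection, $f(t,x,v)=f(t,x,-v)$. **Networks.** For an activation function $\bar\sigma:\mathbb R\to\mathbb R$, a one-hidden-layer network with $m$ hidden nodes, weights $w$ and biases $b$ has the two outputs $$f^{nn}(z)=\sum_{i=1}^m w^{(2)}_{1i}\,\bar\sigma\big(w^{(1)}_i\cdot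 z+b^{(1)}_i\big)+b^{(2)}_1,\qquad h^{nn}(z)=\sum_{i=1}^m w^{(2)}_{2i}\,\bar\sigma\big(w^{(1)}_i\cdot z+b^{(1)}_i\big)+b^{(2)}_2,\qquad z=(t,x,v).$$ **Losses.** Fix a finite set of grid times $\{t_i\}\subset[0,T]$. For functions $F,H$ of $(t,x,v)$ put $$Loss_{GE}=\int_0^T\!\!\int_{-1}^1\!\int_V\big|\partial_tF+v\,\partial_xF-(\sigma\,\partial_vH+\beta\,\partial_v(vF))\big|^2dv\,dx\,dt+\int_0^T\!\!\int_{-1}^1\!\int_V|H-\partial_vF|^2dv\,dx\,dt,$$ $$Loss_{IC}=\int_{-1}^1\int_V|F(0,x,v)-f_0(x,v)|^2dv\,dx,\qquad Loss_{BC}=\sum_{x\in\{-1,1\}}\int_0^T\int_{V_x^-}|F(t,x,v)-G(t,x,v)|^2dv\,dt,$$ where $G=g$ for inflow and $G(t,x,v)=F(t,x,-v)$ for specular reflection, and $$Loss_{Mass}=\sum_i\Big|\frac{d}{dt}\int_{-1}^1\int_VF(t,x,v)\,dv\,dx\Big|^2_{t=t_i}.$$ The total loss is $Loss_{Total}(F,H)=Loss_{GE}+Loss_{IC}+Loss_{BC}$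 for inflow, and $Loss_{Total}(F,H)=Loss_{GE}+Loss_{IC}+Loss_{BC}+Loss_{Mass}$ for specular reflection. **Theorem.** Suppose that $f\in\widehat C^{(1,1,2)}(K)$ and that $\bar\sigma\in C^2(\mathbb R)$ is not a polynomial. Then there is a sequence $(m_{[j]},w_{[j]},b_{[j]})_{j}$ of node numbers, weights and biases whose networks, with outputs $f_j=f^{nn}(\cdot\,;m_{[j]},w_{[j]},b_{[j]})$ and $h_j=h^{nn}(\cdot\,;m_{[j]},w_{[j]},b_{[j]})$, satisfy $$Loss_{Total}(f_j,h_j)\to0\qquad\text{and also}\qquad Loss_{Total}(f_j,\partial_vf_j)\to0\qquad\text{as } j\to\infty .$$ -/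

import Mathlib

noncomputable section

namespace KineticFP

open Set MeasureTheory

/-! ### Multi-index smoothness -/

/-- The partial derivative of `F : ℝⁿ → ℝ` in the `i`-th coordinate. -/
def partialD {n : ℕ} (i : Fin n) (F : (Fin n → ℝ) → ℝ) : (Fin n → ℝ) → ℝ :=
  fun z => lineDeriv ℝ F z (Pi.single i 1)

/-- Iterated partial derivatives: `iterD [i₁, …, iₖ] F = ∂_{i₁} ⋯ ∂_{iₖ} F`. -/
def iterD {n : ℕ} : List (Fin n) → ((Fin n → ℝ) → ℝ) → ((Fin n → ℝ) → ℝ)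
  | [], F => F
  | i :: l, F => partialD i (iterD l F)

/-- `F ∈ C^m(Ω)` for a multi-index `m`: every partial derivative `D^k F` with `k ≤ m`
(componentwise, in any order of differentiation) exists and is continuous on `Ω`. -/
structure ContDiffMulti {n : ℕ} (m : Fin n → ℕ) (F : (Fin n → ℝ) → ℝ)
    (Ω : Set (Fin n → ℝ)) : Prop where
  exists_deriv : ∀ (i : Fin n) (l : List (Fin n)), (∀ q, (i :: l).count q ≤ m q) →
    ∀ z ∈ Ω, LineDifferentiableAt ℝ (iterD l F) z (Pi.single i 1)
  continuous_deriv : ∀ l : List (Fin n), (∀ q, l.count q ≤ m q) → ContinuousOn (iterD l F) Ω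

/-- `F ∈ Ĉ^m(K)`: `F` is `C^m` on some open set that contains `K`. -/
def ContDiffHat {n : ℕ} (m : Fin n → ℕ) (F : (Fin n → ℝ) → ℝ) (K : Set (Fin n → ℝ)) : Prop :=
  ∃ Ω : Set (Fin n → ℝ), IsOpen Ω ∧ K ⊆ Ω ∧ ContDiffMulti m F Ω

/-! ### The domain, the equation and the boundary conditions -/

/-- The truncated velocity domain `V = [-10, 10]`. -/
def V : Set ℝ := Icc (-10) 10

/-- The compact set `[0,T] × [-1,1] × V`, with coordinates `(t, x, v)`. -/
def K (T : ℝ) : Set (Fin 3 → ℝ) :=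
  {z | z 0 ∈ Icc (0 : ℝ) T ∧ z 1 ∈ Icc (-1 : ℝ) 1 ∧ z 2 ∈ V}

/-- The incoming velocities of `V` at the boundary point `x ∈ {-1, 1}`, where the outward
normal is `n_x = x`: those with `n_x · v < 0`. -/
def incoming (x : ℝ) : Set ℝ := {v | v ∈ V ∧ x * v < 0}

/-- The two boundary conditions: inflow with given data `g(t,x,v)`, and specular reflection. -/
inductive BoundaryCondition where
  | inflow (g : ℝ → ℝ → ℝ → ℝ)
  | specular

/-- The value that the boundary condition prescribes on the incoming boundary to a density
`F`: `g(t,x,v)` for inflow and `F(t,x,-v)` for specular reflection. -/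
def BoundaryCondition.datum (bc : BoundaryCondition) (F : ℝ → ℝ → ℝ → ℝ) (t x v : ℝ) : ℝ :=
  match bc with
  | .inflow g => g t x v
  | .specular => F t x (-v)

/-- `f` solves `∂ₜf + v ∂ₓf = ∂ᵥ(σ ∂ᵥf + β v f)` for `t ∈ (0,T)`, `x ∈ (-1,1)`, `v ∈ V`, with
initial value `f₀` and the boundary condition `bc`. -/
structure IsSolution (T σ β : ℝ) (f₀ : ℝ → ℝ → ℝ) (bc : BoundaryCondition)
    (f : ℝ → ℝ → ℝ → ℝ) : Prop where
  equation : ∀ t ∈ Ioo (0 : ℝ) T, ∀ x ∈ Ioo (-1 : ℝ) 1, ∀ v ∈ V,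
    deriv (fun s => f s x v) t + v * deriv (fun y => f t y v) x =
      deriv (fun u => σ * deriv (fun u' => f t x u') u + β * u * f t x u) v
  initial : ∀ x ∈ Ioo (-1 : ℝ) 1, ∀ v ∈ V, f 0 x v = f₀ x v
  boundary : ∀ t ∈ Ioo (0 : ℝ) T, ∀ x ∈ ({-1, 1} : Set ℝ), ∀ v ∈ incoming x,
    f t x v = bc.datum f t x v

/-! ### Networks with one hidden layer -/

/-- Weights and biases of a fully connected network with `3` inputs `(t, x, v)`, one hidden
layer of `m` neurons and `2` outputs. -/
structure Params (m : ℕ) where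
  w₁ : Fin m → Fin 3 → ℝ
  b₁ : Fin m → ℝ
  w₂ : Fin 2 → Fin m → ℝ
  b₂ : Fin 2 → ℝ

/-- The `k`-th output of the network with activation function `act`. -/
def Params.output {m : ℕ} (p : Params m) (act : ℝ → ℝ) (k : Fin 2) (t x v : ℝ) : ℝ :=
  ∑ j, p.w₂ k j * act (∑ i, p.w₁ j i * ![t, x, v] i + p.b₁ j) + p.b₂ k

/-- The first output, the approximation `f^{nn}` of the solution. -/
def Params.fnn {m : ℕ} (p : Params m) (act : ℝ → ℝ) : ℝ → ℝ → ℝ → ℝ := p.output act 0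

/-- The second output, the approximation `h^{nn}` of `∂ᵥ f^{nn}` (reduction of order). -/
def Params.hnn {m : ℕ} (p : Params m) (act : ℝ → ℝ) : ℝ → ℝ → ℝ → ℝ := p.output act 1

/-! ### Loss functions of a pair `(F, H)`, with `H` in the place of `∂ᵥ F` -/

/-- The loss of the governing equation. -/
def lossGE (T σ β : ℝ) (F H : ℝ → ℝ → ℝ → ℝ) : ℝ :=
  (∫ t in Ioo (0 : ℝ) T, ∫ x in Ioo (-1 : ℝ) 1, ∫ v in V,
    |deriv (fun s => F s x v) t + v * deriv (fun y => F t y v) x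
      - (σ * deriv (fun u => H t x u) v + β * deriv (fun u => u * F t x u) v)| ^ 2) +
  ∫ t in Ioo (0 : ℝ) T, ∫ x in Ioo (-1 : ℝ) 1, ∫ v in V,
    |H t x v - deriv (fun u => F t x u) v| ^ 2

/-- The loss of the initial condition. -/
def lossIC (f₀ : ℝ → ℝ → ℝ) (F : ℝ → ℝ → ℝ → ℝ) : ℝ :=
  ∫ x in Ioo (-1 : ℝ) 1, ∫ v in V, |F 0 x v - f₀ x v| ^ 2

/-- The loss of the boundary condition, over the incoming boundary. -/
def lossBC (T : ℝ) (bc : BoundaryCondition) (F : ℝ → ℝ → ℝ → ℝ) : ℝ :=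
  ∑ x ∈ ({-1, 1} : Finset ℝ), ∫ t in Ioo (0 : ℝ) T, ∫ v in incoming x,
    |F t x v - bc.datum F t x v| ^ 2

/-- The loss of the conservation of mass at the grid times `t_i`. -/
def lossMass (times : Finset ℝ) (F : ℝ → ℝ → ℝ → ℝ) : ℝ :=
  ∑ t ∈ times, |deriv (fun s => ∫ x in Ioo (-1 : ℝ) 1, ∫ v in V, F s x v) t| ^ 2

/-- The total loss; the mass term is present for specular reflection, which conserves mass, and
absent for inflow. -/
def lossTotal (T σ β : ℝ) (times : Finset ℝ) (f₀ : ℝ → ℝ → ℝ) (bc : BoundaryCondition)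
    (F H : ℝ → ℝ → ℝ → ℝ) : ℝ :=
  lossGE T σ β F H + lossIC f₀ F + lossBC T bc F +
    match bc with
    | .inflow _ => 0
    | .specular => lossMass times F

end KineticFP

end

noncomputable section

namespace KineticFP

open Set MeasureTheory Filter Topology

/-! ### Closed subspaces and spaces of continuous functions -/

/-! Every loss is controlled by uniform errors on `K T` in `F`, its three first derivatives, `H` and
`∂ᵥH`. The natural plan is to make a network close to `f` in the norm with one derivative in `t` and
`x` and two in `v`.

One obstruction remains. Nothing is imposed at the artificial boundary `v = ±10`, so the mass of `f`
may change in time and `lossMass` of `f` need not vanish. The network therefore approximates `f -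
r`, where `r` depends on time alone and `r'` equals the mean of `∂ₜf` over `(-1,1) × V` at the grid
times in the limit. A sum of narrow spikes does this: `r` tends to 0 uniformly, while `r'` stays
bounded and tends to 0 off the finite grid. The other losses see `r'` only through an integral in
time, so they still tend to 0 by dominated convergence (`tendsto_integral_correctionDeriv`,
`norm_lossTotal_le`).

The density statement is proved for jets, that is, for continuous maps on a compact set that record
the value and the required derivatives. The closed span of the jets of `act (ξ · z + θ)` is stable
under Bochner integrals and under derivatives in parameters. In one variable, mollifying `act` keeps
its jets in the span, and differentiating `k` times in the weight at weight 0 gives the `k`-th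
monomial times a `k`-th derivative that is nonzero somewhere because `act` is not a polynomial
(`polyJet_mem`). Weierstrass approximation, integrated twice, then gives all C² profiles, in
particular sine and cosine. In three variables, Fourier inversion writes a test function as an
integral of sine and cosine ridge functions (`smoothJet_mem`). Cutoff and mollification pass from
test functions to `f - r` (`exists_smooth_near`).

The second output is a separate ridge sum for `∂ᵥ` of the same test function. The second velocity
derivative in the jet is what makes `∂ᵥ` of the first output admissible as `H` too. -/

theorem integral_mem_of_isClosed {α X : Type*} [MeasurableSpace α] {μ : Measure α}
    [NormedAddCommGroup X] [NormedSpace ℝ X] [CompleteSpace X] {M : Submodule ℝ X}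
    (hM : IsClosed (M : Set X)) {h : α → X} (hint : Integrable h μ) (hmem : ∀ a, h a ∈ M) :
    ∫ a, h a ∂μ ∈ M := by
  have : IsClosed (M : Set X) := hM
  -- The quotient map by a closed subspace is continuous and linear, so it commutes with the
  -- integral, and it kills every `h a`.
  have key : M.mkQL (∫ a, h a ∂μ) = 0 := by
    rw [← ContinuousLinearMap.integral_comp_comm _ hint]
    refine integral_eq_zero_of_ae (Eventually.of_forall fun a => ?_)
    simpa using hmem a
  simpa using key

theorem deriv_mem_of_isClosed {X : Type*} [NormedAddCommGroup X] [NormedSpace ℝ X]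
    {M : Submodule ℝ X} (hM : IsClosed (M : Set X)) {u : ℝ → X} {u' : X} {w : ℝ}
    (hu : HasDerivAt u u' w) (hmem : ∀ a, u a ∈ M) : u' ∈ M := by
  have h := hasDerivAt_iff_tendsto_slope.1 hu
  refine hM.mem_of_tendsto h (Eventually.of_forall fun a => ?_)
  exact M.smul_mem _ (M.sub_mem (hmem _) (hmem _))

/-- Pointwise derivatives become derivatives in the sup norm once the candidate derivative is a
continuous curve in `C(S, F)`: by the fundamental theorem at each point, `U` is the primitive of `W`
as a vector-valued integral. -/
theorem hasDerivAt_continuousMap {S F : Type*} [TopologicalSpace S] [CompactSpace S]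
    [NormedAddCommGroup F] [NormedSpace ℝ F] [CompleteSpace F] {U W : ℝ → C(S, F)}
    (hW : Continuous W) (hUW : ∀ s w, HasDerivAt (fun a => U a s) (W w s) w) (w : ℝ) :
    HasDerivAt U (W w) w := by
  have hU : U = fun a => U w + ∫ b in w..a, W b := by
    funext a
    ext s
    have h1 := intervalIntegral.integral_eq_sub_of_hasDerivAt
      (a := w) (b := a) (fun x _ => hUW s x)
      (((continuous_eval_const s).comp hW).intervalIntegrable _ _)
    have h2 := (ContinuousMap.evalCLM ℝ s).intervalIntegral_comp_comm
      (hW.intervalIntegrable (μ := volume) w a)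
    simp only [ContinuousMap.evalCLM_apply] at h2
    rw [ContinuousMap.add_apply, ← h2, h1]
    abel
  rw [hU]
  exact (intervalIntegral.integral_hasDerivAt_right (hW.intervalIntegrable _ _)
    (hW.stronglyMeasurableAtFilter _ _) hW.continuousAt).const_add _

/-! ### Convolution and directional derivatives -/

/-- The convolution `φ ⋆ F` of real functions. -/
def conv {E : Type*} [NormedAddCommGroup E] [MeasurableSpace E] (μ : Measure E)
    (φ F : E → ℝ) : E → ℝ := fun z => ∫ y, φ y * F (z - y) ∂μ

theorem conv_integrable {E : Type*} [NormedAddCommGroup E] [MeasurableSpace E] [BorelSpace E]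
    {μ : Measure E} [IsFiniteMeasureOnCompacts μ] {φ F : E → ℝ}
    (hφ : Continuous φ) (hφs : HasCompactSupport φ) (hF : Continuous F) (z : E) :
    Integrable (fun y => φ y * F (z - y)) μ :=
  Continuous.integrable_of_hasCompactSupport (by fun_prop) hφs.mul_right

theorem hasLineDerivAt_conv {E : Type*} [NormedAddCommGroup E] [NormedSpace ℝ E]
    [MeasurableSpace E] [BorelSpace E] {μ : Measure E} [IsFiniteMeasureOnCompacts μ]
    {φ F F' : E → ℝ} {v : E} (hφ : Continuous φ) (hφs : HasCompactSupport φ)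
    (hF : Continuous F) (hF' : Continuous F') (h : ∀ z, HasLineDerivAt ℝ F (F' z) z v) (z : E) :
    HasLineDerivAt ℝ (conv μ φ F) (conv μ φ F' z) z v := by
  -- All points at which `F'` is evaluated while `|t| ≤ 1` and `φ y ≠ 0` lie in this compact set,
  -- which yields an integrable dominating function.
  have hK : IsCompact ((fun p : ℝ × E => z + p.1 • v - p.2) '' (Icc (-1) 1 ×ˢ tsupport φ)) :=
    (isCompact_Icc.prod hφs).image (by fun_prop)
  obtain ⟨C, hC⟩ := hK.exists_bound_of_continuousOn hF'.continuousOn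
  have hderiv : ∀ y t, HasDerivAt (fun t : ℝ => φ y * F (z + t • v - y))
      (φ y * F' (z + t • v - y)) t := by
    intro y t
    have h1 : HasDerivAt (fun s : ℝ => F (z + t • v - y + s • v)) (F' (z + t • v - y)) 0 :=
      h (z + t • v - y)
    have h2 : HasDerivAt (fun s : ℝ => F (z + t • v - y + (s - t) • v)) (F' (z + t • v - y)) t := by
      have := HasDerivAt.comp_sub_const t t (f := fun s : ℝ => F (z + t • v - y + s • v))
        (f' := F' (z + t • v - y)) (by simpa using h1)
      exact this
    refine (h2.congr_of_eventuallyEq (Eventually.of_forall fun s => ?_)).const_mul (φ y)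
    simp only [sub_smul]
    congr 1
    abel
  have := hasDerivAt_integral_of_dominated_loc_of_deriv_le (μ := μ)
    (F := fun (t : ℝ) y => φ y * F (z + t • v - y))
    (F' := fun (t : ℝ) y => φ y * F' (z + t • v - y)) (x₀ := 0) (s := Icc (-1) 1)
    (bound := fun y => ‖φ y‖ * C) (Icc_mem_nhds (by norm_num) (by norm_num))
    (Eventually.of_forall fun t => (conv_integrable hφ hφs hF _).aestronglyMeasurable)
    (conv_integrable hφ hφs hF _) (conv_integrable hφ hφs hF' _).aestronglyMeasurable
    (Eventually.of_forall fun y t ht => ?_)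
    ((hφ.integrable_of_hasCompactSupport hφs).norm.mul_const C)
    (Eventually.of_forall fun y t _ => hderiv y t)
  · simpa [HasLineDerivAt, conv] using this.2
  · rw [norm_mul]
    by_cases hy : φ y = 0
    · simp [hy]
    · exact mul_le_mul_of_nonneg_left (hC _ ⟨(t, y), ⟨ht, subset_tsupport _ hy⟩, rfl⟩)
        (norm_nonneg _)

theorem contDiff_conv {E : Type*} [NormedAddCommGroup E] [NormedSpace ℝ E]
    [MeasurableSpace E] [BorelSpace E] [FiniteDimensional ℝ E] {μ : Measure E}
    [μ.IsAddHaarMeasure]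
    {φ F : E → ℝ} (hφ : ContDiff ℝ (⊤ : ℕ∞) φ) (hφs : HasCompactSupport φ) (hF : Continuous F) :
    ContDiff ℝ (⊤ : ℕ∞) (conv μ φ F) := by
  have h := hφs.contDiff_convolution_left (ContinuousLinearMap.mul ℝ ℝ) (μ := μ) hφ
    hF.locallyIntegrable
  exact h

/-! ### Second order jets of ridge functions on an interval -/

/-- The second order jet `(g₀, w g₁, w² g₂)(w s + θ)` on `[-R, R]`; this is the jet of
`s ↦ g₀ (w s + θ)` if `g₁ = g₀'` and `g₂ = g₁'`. -/
def affineJet (R : ℝ) (g₀ g₁ g₂ : C(ℝ, ℝ)) (w θ : ℝ) : C(Icc (-R) R, ℝ × ℝ × ℝ) :=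
  ⟨fun s => (g₀ (w * s + θ), w * g₁ (w * s + θ), w ^ 2 * g₂ (w * s + θ)), by fun_prop⟩

theorem continuous_affineJet (R : ℝ) (g₀ g₁ g₂ : C(ℝ, ℝ)) :
    Continuous fun p : ℝ × ℝ => affineJet R g₀ g₁ g₂ p.1 p.2 := by
  refine ContinuousMap.continuous_of_continuous_uncurry _ ?_
  simp only [affineJet, Function.uncurry_def, ContinuousMap.coe_mk]
  fun_prop

/-- The closed span of the jets of all `s ↦ g₀ (w s + θ)`. -/
def affineSpan (R : ℝ) (g₀ g₁ g₂ : C(ℝ, ℝ)) : Submodule ℝ C(Icc (-R) R, ℝ × ℝ × ℝ) :=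
  (Submodule.span ℝ (range fun p : ℝ × ℝ => affineJet R g₀ g₁ g₂ p.1 p.2)).topologicalClosure

theorem isClosed_affineSpan (R : ℝ) (g₀ g₁ g₂ : C(ℝ, ℝ)) :
    IsClosed (affineSpan R g₀ g₁ g₂ : Set C(Icc (-R) R, ℝ × ℝ × ℝ)) :=
  Submodule.isClosed_topologicalClosure _

theorem affineJet_mem (R : ℝ) (g₀ g₁ g₂ : C(ℝ, ℝ)) (w θ : ℝ) :
    affineJet R g₀ g₁ g₂ w θ ∈ affineSpan R g₀ g₁ g₂ :=
  Submodule.le_topologicalClosure _ (Submodule.subset_span ⟨(w, θ), rfl⟩)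

/-- Convolution only averages over the bias: the new jet is the Bochner integral of `φ y` times the
old jet at bias `θ - y`. Thus `act` may be replaced by smooth mollifications without leaving the
closed span. -/
theorem affineJet_conv_mem (R : ℝ) (g₀ g₁ g₂ h₀ h₁ h₂ : C(ℝ, ℝ)) {φ : ℝ → ℝ}
    (hφ : Continuous φ) (hφs : HasCompactSupport φ)
    (e₀ : ∀ x, h₀ x = conv volume φ g₀ x) (e₁ : ∀ x, h₁ x = conv volume φ g₁ x)
    (e₂ : ∀ x, h₂ x = conv volume φ g₂ x) (w θ : ℝ) :
    affineJet R h₀ h₁ h₂ w θ ∈ affineSpan R g₀ g₁ g₂ := by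
  have hc : Continuous fun y => φ y • affineJet R g₀ g₁ g₂ w (θ - y) :=
    hφ.smul ((continuous_affineJet R g₀ g₁ g₂).comp (by fun_prop : Continuous fun y => (w, θ - y)))
  have hi : Integrable fun y => φ y • affineJet R g₀ g₁ g₂ w (θ - y) :=
    hc.integrable_of_hasCompactSupport hφs.smul_right
  have key : affineJet R h₀ h₁ h₂ w θ = ∫ y, φ y • affineJet R g₀ g₁ g₂ w (θ - y) := by
    ext1 s
    have h1 := (ContinuousMap.evalCLM ℝ s).integral_comp_comm hi
    simp only [ContinuousMap.evalCLM_apply] at h1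
    rw [← h1]
    have hs : Integrable fun y => (φ y • affineJet R g₀ g₁ g₂ w (θ - y)) s :=
      (ContinuousMap.evalCLM ℝ s).integrable_comp hi
    refine Prod.ext ?_ (Prod.ext ?_ ?_)
    · rw [fst_integral hs]
      simp [affineJet, e₀, conv, add_sub_assoc]
    · rw [snd_integral hs, fst_integral hs.snd]
      simp only [affineJet, e₁, conv, ContinuousMap.coe_mk, ContinuousMap.smul_apply,
        Prod.smul_snd, Prod.smul_fst, smul_eq_mul, ← integral_const_mul, add_sub_assoc]
      exact integral_congr_ae (Eventually.of_forall fun y => by ring)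
    · rw [snd_integral hs, snd_integral hs.snd]
      simp only [affineJet, e₂, conv, ContinuousMap.coe_mk, ContinuousMap.smul_apply,
        Prod.smul_snd, smul_eq_mul, ← integral_const_mul, add_sub_assoc]
      exact integral_congr_ae (Eventually.of_forall fun y => by ring)
  rw [key]
  exact integral_mem_of_isClosed (isClosed_affineSpan _ _ _ _) hi
    fun y => Submodule.smul_mem _ _ (affineJet_mem _ _ _ _ _ _)

/-- The second order jet of `s ↦ s ^ k * h k (w s + θ)` on `[-R, R]`, where `h (j + 1)` is the
derivative of `h j`; this is the `k`-th derivative in `w` of the jet of `s ↦ h 0 (w s + θ)`. -/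
def monomialJet (R : ℝ) (h : ℕ → C(ℝ, ℝ)) (θ : ℝ) (k : ℕ) (w : ℝ) :
    C(Icc (-R) R, ℝ × ℝ × ℝ) :=
  ⟨fun s => ((s : ℝ) ^ k * h k (w * s + θ),
    k * (s : ℝ) ^ (k - 1) * h k (w * s + θ) + w * (s : ℝ) ^ k * h (k + 1) (w * s + θ),
    k * (k - 1 : ℕ) * (s : ℝ) ^ (k - 2) * h k (w * s + θ)
      + 2 * k * w * (s : ℝ) ^ (k - 1) * h (k + 1) (w * s + θ)
      + w ^ 2 * (s : ℝ) ^ k * h (k + 2) (w * s + θ)), by fun_prop⟩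

theorem continuous_monomialJet (R : ℝ) (h : ℕ → C(ℝ, ℝ)) (θ : ℝ) (k : ℕ) :
    Continuous (monomialJet R h θ k) := by
  refine ContinuousMap.continuous_of_continuous_uncurry _ ?_
  simp only [monomialJet, Function.uncurry_def, ContinuousMap.coe_mk]
  fun_prop

theorem hasDerivAt_monomialJet (R : ℝ) (h : ℕ → C(ℝ, ℝ))
    (hh : ∀ j x, HasDerivAt (h j) (h (j + 1) x) x) (θ : ℝ) (k : ℕ) (w : ℝ) :
    HasDerivAt (monomialJet R h θ k) (monomialJet R h θ (k + 1) w) w := by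
  refine hasDerivAt_continuousMap (continuous_monomialJet R h θ (k + 1)) (fun s a => ?_) w
  have hd : ∀ j, HasDerivAt (fun b : ℝ => h j (b * s + θ)) (h (j + 1) (a * s + θ) * s) a := by
    intro j
    have h1 : HasDerivAt (fun b : ℝ => b * (s : ℝ) + θ) s a := by
      simpa using ((hasDerivAt_id a).mul_const (s : ℝ)).add_const θ
    exact (hh j _).comp a h1
  have hid := hasDerivAt_id' a
  simp only [monomialJet, ContinuousMap.coe_mk]
  refine HasDerivAt.prodMk ?_ (HasDerivAt.prodMk ?_ ?_)
  · refine ((hd k).const_mul ((s : ℝ) ^ k)).congr_deriv ?_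
    ring
  · refine (((hd k).const_mul (k * (s : ℝ) ^ (k - 1))).add
      ((hid.mul_const ((s : ℝ) ^ k)).mul (hd (k + 1)))).congr_deriv ?_
    -- Natural subtraction truncates in the exponents and in the factor `k - 1`; the small cases are
    -- separate because there the vanishing coefficient removes the ill-formed power.
    rcases k with _ | k
    · simp; ring
    · simp only [Nat.add_sub_cancel]; push_cast; ring
  · refine ((((hd k).const_mul (k * (k - 1 : ℕ) * (s : ℝ) ^ (k - 2))).add
      (((hid.const_mul (2 * k : ℝ)).mul_const ((s : ℝ) ^ (k - 1))).mul (hd (k + 1)))).add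
      (((hasDerivAt_pow 2 a).mul_const ((s : ℝ) ^ k)).mul (hd (k + 2)))).congr_deriv ?_
    rcases k with _ | _ | k
    · simp; ring
    · simp; ring
    · simp only [Nat.add_sub_cancel, Nat.reduceSubDiff]; push_cast; ring

/-- A closed subspace contains the derivatives of curves lying in it. Membership is carried for all
weights `w`, since the induction differentiates in `w`. -/
theorem monomialJet_mem {R : ℝ} {h : ℕ → C(ℝ, ℝ)}
    {M : Submodule ℝ C(Icc (-R) R, ℝ × ℝ × ℝ)} (hM : IsClosed (M : Set C(Icc (-R) R, ℝ × ℝ × ℝ)))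
    (hh : ∀ j x, HasDerivAt (h j) (h (j + 1) x) x) {θ : ℝ}
    (h0 : ∀ w, affineJet R (h 0) (h 1) (h 2) w θ ∈ M) (k : ℕ) (w : ℝ) :
    monomialJet R h θ k w ∈ M := by
  induction k generalizing w with
  | zero =>
    convert h0 w using 1
    ext1 s
    simp [monomialJet, affineJet]
  | succ k ih => exact deriv_mem_of_isClosed hM (hasDerivAt_monomialJet R h hh θ k w) ih

/-- The jet of a polynomial on `[-R, R]`. -/
def polyJet (R : ℝ) : Polynomial ℝ →ₗ[ℝ] C(Icc (-R) R, ℝ × ℝ × ℝ) where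
  toFun p := ⟨fun s => (p.eval (s : ℝ), p.derivative.eval (s : ℝ),
    p.derivative.derivative.eval (s : ℝ)), by fun_prop⟩
  map_add' p q := by ext1 s; simp
  map_smul' c p := by ext1 s; simp

/-- At weight 0 the argument of `h k` no longer depends on `s`, and every term with a higher
derivative of `h k` carries a factor `w`. -/
theorem polyJet_X_pow (R : ℝ) (h : ℕ → C(ℝ, ℝ)) (θ : ℝ) (k : ℕ) :
    monomialJet R h θ k 0 = h k θ • polyJet R (Polynomial.X ^ k) := by
  ext1 s
  simp [monomialJet, polyJet, Polynomial.derivative_X_pow]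
  refine ⟨by ring, by ring, ?_⟩
  rcases k with _ | k
  · simp
  · simp; ring

/-! ### Polynomial limits -/

theorem eq_taylor_of_iteratedDeriv_eq_zero (k : ℕ) (h : ℕ → ℝ → ℝ)
    (hh : ∀ j x, HasDerivAt (h j) (h (j + 1) x) x) (hk : ∀ x, h k x = 0) :
    h 0 ∈ Submodule.span ℝ (range fun i : Fin k => fun x : ℝ => x ^ (i : ℕ)) := by
  induction k generalizing h with
  | zero =>
    have : h 0 = 0 := funext hk
    simp [this]
  | succ k ih =>
    have h1 := ih (fun j => h (j + 1)) (fun j x => hh (j + 1) x) hk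
    obtain ⟨c, hc⟩ := (Submodule.mem_span_range_iff_exists_fun ℝ).1 h1
    have hc' : ∀ x, h 1 x = ∑ i, c i * x ^ (i : ℕ) := fun x => by
      have := congrFun hc x
      simp only [Finset.sum_apply, Pi.smul_apply, smul_eq_mul] at this
      exact this.symm
    have hconst : ∀ x, HasDerivAt
        (fun x => h 0 x - ∑ i : Fin k, c i / ((i : ℕ) + 1) * x ^ ((i : ℕ) + 1)) 0 x := by
      intro x
      have h2 := (hh 0 x).sub (HasDerivAt.fun_sum (u := Finset.univ) fun (i : Fin k) _ =>
        (hasDerivAt_pow ((i : ℕ) + 1) x).const_mul (c i / ((i : ℕ) + 1)))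
      refine h2.congr_deriv ?_
      rw [zero_add, hc', sub_eq_zero]
      refine Finset.sum_congr rfl fun i _ => ?_
      have : ((i : ℕ) : ℝ) + 1 ≠ 0 := by positivity
      push_cast
      field_simp
    have hall : ∀ x, h 0 x = h 0 0 + ∑ i : Fin k, c i / ((i : ℕ) + 1) * x ^ ((i : ℕ) + 1) := by
      intro x
      have := is_const_of_deriv_eq_zero (fun x => (hconst x).differentiableAt)
        (fun x => (hconst x).deriv) x 0
      simp at this
      linarith
    refine (Submodule.mem_span_range_iff_exists_fun ℝ).2
      ⟨Fin.cons (h 0 0) fun i => c i / ((i : ℕ) + 1), ?_⟩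
    ext x
    rw [hall x, Finset.sum_apply, Fin.sum_univ_succ]
    simp

theorem exists_polynomial_of_mem_span {k : ℕ} {g : ℝ → ℝ}
    (hg : g ∈ Submodule.span ℝ (range fun i : Fin k => fun x : ℝ => x ^ (i : ℕ))) :
    ∃ p : Polynomial ℝ, ∀ y, g y = p.eval y := by
  obtain ⟨c, rfl⟩ := (Submodule.mem_span_range_iff_exists_fun ℝ).1 hg
  exact ⟨∑ i : Fin k, Polynomial.C (c i) * Polynomial.X ^ (i : ℕ), fun y => by
    simp [Polynomial.eval_finsetSum]⟩

/-- A sequence of smooth bumps shrinking to the origin. -/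
def shrinkingBump (E : Type*) [NormedAddCommGroup E] (n : ℕ) : ContDiffBump (0 : E) where
  rIn := 1 / ((n : ℝ) + 1) / 2
  rOut := 1 / ((n : ℝ) + 1)
  rIn_pos := by positivity
  rIn_lt_rOut := half_lt_self (by positivity)

/-- Otherwise every mollification of `act` would be a polynomial of degree below `k`, and so would
be their pointwise limit `act`. -/
theorem exists_conv_iteratedDeriv_ne_zero {act : ℝ → ℝ} (hact : Continuous act)
    (hnp : ¬ ∃ p : Polynomial ℝ, ∀ y, act y = p.eval y) (k : ℕ) :
    ∃ φ : ℝ → ℝ, ContDiff ℝ (⊤ : ℕ∞) φ ∧ HasCompactSupport φ ∧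
      ∃ θ, iteratedDeriv k (conv volume φ act) θ ≠ 0 := by
  by_contra! hcon
  apply hnp
  set W := Submodule.span ℝ (range fun i : Fin k => fun x : ℝ => x ^ (i : ℕ)) with hWdef
  have hfin : FiniteDimensional ℝ W := FiniteDimensional.span_of_finite ℝ (finite_range _)
  -- The topology is that of pointwise convergence, where finite-dimensional subspaces are closed;
  -- pointwise convergence of the mollifications therefore suffices.
  have hW : IsClosed (W : Set (ℝ → ℝ)) := W.closed_of_finiteDimensional
  let B := shrinkingBump ℝ
  have hB : Tendsto (fun n => (B n).rOut) atTop (𝓝 0) := tendsto_one_div_add_atTop_nhds_zero_nat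
  have hlim : Tendsto (fun n => conv volume ((B n).normed volume) act) atTop (𝓝 act) :=
    tendsto_pi_nhds.2 fun x =>
      ContDiffBump.convolution_tendsto_right_of_continuous hB hact x
  refine exists_polynomial_of_mem_span (k := k)
    (hW.mem_of_tendsto hlim (Eventually.of_forall fun n => ?_))
  have hsm := contDiff_conv (μ := volume) ((B n).contDiff_normed (μ := volume) (n := ⊤))
    (B n).hasCompactSupport_normed hact
  have := eq_taylor_of_iteratedDeriv_eq_zero k
    (fun j => iteratedDeriv j (conv volume ((B n).normed volume) act)) (fun j x => ?_)
    (hcon _ (B n).contDiff_normed (B n).hasCompactSupport_normed)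
  · simpa using this
  · rw [iteratedDeriv_succ]
    exact ((hsm.differentiable_iteratedDeriv j
      (by exact_mod_cast WithTop.coe_lt_top _)) x).hasDerivAt

theorem hasDerivAt_conv {φ F F' : ℝ → ℝ} (hφ : Continuous φ) (hφs : HasCompactSupport φ)
    (hF : Continuous F) (hF' : Continuous F') (h : ∀ x, HasDerivAt F (F' x) x) (x : ℝ) :
    HasDerivAt (conv volume φ F) (conv volume φ F' x) x := by
  have h1 := hasLineDerivAt_conv (μ := volume) (v := (1 : ℝ)) hφ hφs hF hF'
    (fun z => by simpa using (h z).hasFDerivAt.hasLineDerivAt 1) x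
  have h2 : HasDerivAt (fun t => conv volume φ F (x + t)) (conv volume φ F' x) (x - x) := by
    simpa [HasLineDerivAt] using h1
  simpa using h2.comp_sub_const x x

/-- The mollifier and the bias may depend on the degree `k`, so it is enough that for each `k` some
mollification has a nonzero `k`-th derivative somewhere; dividing by that value isolates the
monomial. -/
theorem polyJet_mem (R : ℝ) {a₀ a₁ a₂ : C(ℝ, ℝ)} (h₁ : ∀ x, HasDerivAt a₀ (a₁ x) x)
    (h₂ : ∀ x, HasDerivAt a₁ (a₂ x) x)
    (hnp : ¬ ∃ p : Polynomial ℝ, ∀ y, a₀ y = p.eval y) (p : Polynomial ℝ) :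
    polyJet R p ∈ affineSpan R a₀ a₁ a₂ := by
  have hX : ∀ k : ℕ, polyJet R (Polynomial.X ^ k) ∈ affineSpan R a₀ a₁ a₂ := by
    intro k
    obtain ⟨φ, hφ, hφs, θ, hθ⟩ := exists_conv_iteratedDeriv_ne_zero a₀.continuous hnp k
    have hsm := contDiff_conv (μ := volume) hφ hφs a₀.continuous
    let h : ℕ → C(ℝ, ℝ) := fun j => ⟨iteratedDeriv j (conv volume φ a₀),
      hsm.continuous_iteratedDeriv j (by exact_mod_cast le_top)⟩
    have hh : ∀ j x, HasDerivAt (h j) (h (j + 1) x) x := fun j x => by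
      simp only [h, ContinuousMap.coe_mk]
      rw [iteratedDeriv_succ]
      exact ((hsm.differentiable_iteratedDeriv j
        (by exact_mod_cast WithTop.coe_lt_top _)) x).hasDerivAt
    have e₀ : ∀ x, h 0 x = conv volume φ a₀ x := fun x => by simp [h]
    have e₁ : ∀ x, h 1 x = conv volume φ a₁ x := fun x =>
      (hh 0 x).unique (by
        rw [show ⇑(h 0) = conv volume φ a₀ from funext e₀]
        exact hasDerivAt_conv hφ.continuous hφs a₀.continuous a₁.continuous h₁ x)
    have e₂ : ∀ x, h 2 x = conv volume φ a₂ x := fun x =>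
      (hh 1 x).unique (by
        rw [show ⇑(h 1) = conv volume φ a₁ from funext e₁]
        exact hasDerivAt_conv hφ.continuous hφs a₁.continuous a₂.continuous h₂ x)
    have hmem := monomialJet_mem (isClosed_affineSpan R a₀ a₁ a₂) hh (θ := θ)
      (fun w => affineJet_conv_mem R a₀ a₁ a₂ _ _ _ hφ.continuous hφs e₀ e₁ e₂ w θ) k 0
    rw [polyJet_X_pow] at hmem
    exact (Submodule.smul_mem_iff _ hθ).1 hmem
  induction p using Polynomial.induction_on' with
  | add p q hp hq => rw [map_add]; exact Submodule.add_mem _ hp hq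
  | monomial n c =>
    rw [← Polynomial.C_mul_X_pow_eq_monomial, ← Polynomial.smul_eq_C_mul, map_smul]
    exact Submodule.smul_mem _ _ (hX n)

/-! ### Polynomial approximation with two derivatives -/

theorem exists_polynomial_derivative_eq (q : Polynomial ℝ) :
    ∃ p : Polynomial ℝ, p.derivative = q := by
  induction q using Polynomial.induction_on' with
  | add p q hp hq =>
    obtain ⟨a, rfl⟩ := hp
    obtain ⟨b, rfl⟩ := hq
    exact ⟨a + b, by simp⟩
  | monomial n c =>
    refine ⟨Polynomial.monomial (n + 1) (c / (n + 1)), ?_⟩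
    have : (n : ℝ) + 1 ≠ 0 := by positivity
    rw [Polynomial.derivative_monomial]
    push_cast
    rw [div_mul_cancel₀ _ this]

theorem exists_polynomial_antideriv_near {R ε : ℝ} (hR : 0 ≤ R) {g g' : ℝ → ℝ}
    (hg : ∀ x, HasDerivAt g (g' x) x) {q : Polynomial ℝ}
    (hq : ∀ s ∈ Icc (-R) R, |q.eval s - g' s| ≤ ε) :
    ∃ p : Polynomial ℝ, p.derivative = q ∧ ∀ s ∈ Icc (-R) R, |p.eval s - g s| ≤ ε * R := by
  obtain ⟨p₀, rfl⟩ := exists_polynomial_derivative_eq q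
  -- The primitive is normalised to agree with `g` at 0, so the mean value inequality costs only a
  -- factor `R`.
  refine ⟨p₀ + Polynomial.C (g 0 - p₀.eval 0), by simp, fun s hs => ?_⟩
  have h0 : (0 : ℝ) ∈ Icc (-R) R := ⟨by linarith, hR⟩
  have := (convex_Icc (-R) R).norm_image_sub_le_of_norm_hasDerivWithin_le
    (f := fun x => p₀.eval x - g x) (f' := fun x => p₀.derivative.eval x - g' x) (C := ε)
    (fun x _ => ((p₀.hasDerivAt x).sub (hg x)).hasDerivWithinAt) hq h0 hs
  have hε : 0 ≤ ε := (abs_nonneg _).trans (hq 0 h0)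
  calc |(p₀ + Polynomial.C (g 0 - p₀.eval 0)).eval s - g s|
      = ‖p₀.eval s - g s - (p₀.eval 0 - g 0)‖ := by
        rw [Real.norm_eq_abs, Polynomial.eval_add, Polynomial.eval_C]; congr 1; ring
    _ ≤ ε * ‖s - 0‖ := this
    _ ≤ ε * R := by
        rw [sub_zero, Real.norm_eq_abs]
        exact mul_le_mul_of_nonneg_left (abs_le.2 hs) hε

theorem exists_polyJet_near {R ε : ℝ} (hR : 0 ≤ R) (hε : 0 < ε) {g₀ g₁ g₂ : C(ℝ, ℝ)}
    (h₁ : ∀ x, HasDerivAt g₀ (g₁ x) x) (h₂ : ∀ x, HasDerivAt g₁ (g₂ x) x) :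
    ∃ p : Polynomial ℝ, dist (affineJet R g₀ g₁ g₂ 1 0) (polyJet R p) ≤ ε := by
  -- Integrating twice from an error `δ` in the second derivative gives errors `δ R` and `δ R²`; all
  -- three are at most `δ (1 + R)² = ε`.
  set δ := ε / (1 + R) ^ 2 with hδ
  have hδ0 : 0 < δ := by positivity
  obtain ⟨q, hq⟩ := exists_polynomial_near_continuousMap (-R) R
    (g₂.restrict (Icc (-R) R)) δ hδ0
  have hq2 : ∀ s ∈ Icc (-R) R, |q.eval s - g₂ s| ≤ δ := fun s hs => by
    have := (ContinuousMap.norm_coe_le_norm _ (⟨s, hs⟩ : Icc (-R) R)).trans hq.le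
    simpa using this
  obtain ⟨q₁, rfl, hq1⟩ := exists_polynomial_antideriv_near hR h₂ hq2
  obtain ⟨q₀, rfl, hq0⟩ := exists_polynomial_antideriv_near hR h₁ hq1
  have hb : δ * (1 + R) ^ 2 = ε := by rw [hδ]; field_simp
  refine ⟨q₀, (ContinuousMap.dist_le hε.le).2 fun s => ?_⟩
  have hc0 := hq0 s s.2
  have hc1 := hq1 s s.2
  have hc2 := hq2 s s.2
  have p1 : 0 ≤ δ * R := by positivity
  have p2 : 0 ≤ δ * R * R := by positivity
  rw [dist_comm, dist_eq_norm]
  simp only [affineJet, polyJet, LinearMap.coe_mk, AddHom.coe_mk, ContinuousMap.coe_mk, one_mul,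
    add_zero, one_pow, Prod.mk_sub_mk, Prod.norm_mk, Real.norm_eq_abs]
  refine max_le ?_ (max_le ?_ ?_) <;> nlinarith

theorem affineJet_mem_of_not_polynomial {R : ℝ} (hR : 0 ≤ R) {a₀ a₁ a₂ : C(ℝ, ℝ)}
    (h₁ : ∀ x, HasDerivAt a₀ (a₁ x) x) (h₂ : ∀ x, HasDerivAt a₁ (a₂ x) x)
    (hnp : ¬ ∃ p : Polynomial ℝ, ∀ y, a₀ y = p.eval y) {g₀ g₁ g₂ : C(ℝ, ℝ)}
    (hg₁ : ∀ x, HasDerivAt g₀ (g₁ x) x) (hg₂ : ∀ x, HasDerivAt g₁ (g₂ x) x) :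
    affineJet R g₀ g₁ g₂ 1 0 ∈ affineSpan R a₀ a₁ a₂ := by
  rw [← SetLike.mem_coe, ← (isClosed_affineSpan R a₀ a₁ a₂).closure_eq]
  refine Metric.mem_closure_iff.2 fun ε hε => ?_
  obtain ⟨p, hp⟩ := exists_polyJet_near hR (half_pos hε) hg₁ hg₂
  exact ⟨_, polyJet_mem R h₁ h₂ hnp p, hp.trans_lt (half_lt_self hε)⟩

/-! ### Jets of ridge functions of three variables -/

/-- The points `(t, x, v)`, with the Euclidean norm. -/
abbrev E3 : Type := EuclideanSpace ℝ (Fin 3)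

/-- The jet (value, gradient, second derivative in the last coordinate) of
`z ↦ g₀ (⟪ξ, z⟫ + θ)`, where `g₁ = g₀'` and `g₂ = g₁'`. -/
def ridgeJet (S : Set E3) (g₀ g₁ g₂ : C(ℝ, ℝ)) (ξ : E3) (θ : ℝ) :
    C(S, ℝ × (Fin 3 → ℝ) × ℝ) :=
  ⟨fun z => (g₀ (inner ℝ ξ (z : E3) + θ), fun i => ξ i * g₁ (inner ℝ ξ (z : E3) + θ),
    ξ 2 ^ 2 * g₂ (inner ℝ ξ (z : E3) + θ)), by fun_prop⟩

theorem continuous_ridgeJet (S : Set E3) (g₀ g₁ g₂ : C(ℝ, ℝ)) (θ : ℝ) :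
    Continuous fun ξ => ridgeJet S g₀ g₁ g₂ ξ θ := by
  refine ContinuousMap.continuous_of_continuous_uncurry _ ?_
  simp only [ridgeJet, Function.uncurry_def, ContinuousMap.coe_mk]
  fun_prop

/-- The closed span of the jets of all `z ↦ g₀ (⟪ξ, z⟫ + θ)`. -/
def ridgeSpan (S : Set E3) (g₀ g₁ g₂ : C(ℝ, ℝ)) : Submodule ℝ C(S, ℝ × (Fin 3 → ℝ) × ℝ) :=
  (Submodule.span ℝ (range fun p : E3 × ℝ => ridgeJet S g₀ g₁ g₂ p.1 p.2)).topologicalClosure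

/-- The linear map `(u₀, u₁, u₂) ↦ (u₀, u₁ ξ, u₂ ξ₂²)`, which turns jets of functions of
`⟪ξ, z⟫` into jets of functions of `z`. -/
def ridgeMap (ξ : E3) : ℝ × ℝ × ℝ →L[ℝ] ℝ × (Fin 3 → ℝ) × ℝ :=
  LinearMap.toContinuousLinearMap
    { toFun := fun u => (u.1, fun i => ξ i * u.2.1, ξ 2 ^ 2 * u.2.2)
      map_add' := fun u v => by
        refine Prod.ext rfl (Prod.ext ?_ ?_)
        · funext i; simp [mul_add]
        · simp [mul_add]
      map_smul' := fun c u => by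
        refine Prod.ext rfl (Prod.ext ?_ ?_)
        · funext i; simp; ring
        · simp; ring }

/-- For fixed `ξ`, substituting `s = ⟪ξ, z⟫` is a continuous linear map from one-variable jets to
three-variable jets. It sends the spanning jets of weight `w` to ridge jets of direction `w • ξ`,
hence closed span into closed span. -/
theorem ridgeJet_mem {S : Set E3} [CompactSpace S] {a₀ a₁ a₂ : C(ℝ, ℝ)}
    (h₁ : ∀ x, HasDerivAt a₀ (a₁ x) x) (h₂ : ∀ x, HasDerivAt a₁ (a₂ x) x)
    (hnp : ¬ ∃ p : Polynomial ℝ, ∀ y, a₀ y = p.eval y) {g₀ g₁ g₂ : C(ℝ, ℝ)}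
    (hg₁ : ∀ x, HasDerivAt g₀ (g₁ x) x) (hg₂ : ∀ x, HasDerivAt g₁ (g₂ x) x) (ξ : E3) :
    ridgeJet S g₀ g₁ g₂ ξ 0 ∈ ridgeSpan S a₀ a₁ a₂ := by
  obtain ⟨B, hB⟩ := (isCompact_iff_compactSpace.2 ‹CompactSpace S›).exists_bound_of_continuousOn
    (f := fun z : E3 => inner ℝ ξ z) (by fun_prop)
  let R := max B 0
  let ι : C(S, Icc (-R) R) := ⟨fun z => ⟨inner ℝ ξ (z : E3),
    abs_le.1 ((hB z z.2).trans (le_max_left _ _))⟩, by fun_prop⟩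
  let T : C(Icc (-R) R, ℝ × ℝ × ℝ) →ₗ[ℝ] C(S, ℝ × (Fin 3 → ℝ) × ℝ) :=
    { toFun := fun u => ((ridgeMap ξ : C(ℝ × ℝ × ℝ, ℝ × (Fin 3 → ℝ) × ℝ)).comp u).comp ι
      map_add' := fun u v => by ext1 z; simp
      map_smul' := fun c u => by ext1 z; simp }
  have hT : Continuous T :=
    (ContinuousMap.continuous_precomp ι).comp (ContinuousMap.continuous_postcomp _)
  have hTa : ∀ (b₀ b₁ b₂ : C(ℝ, ℝ)) (w θ : ℝ),
      T (affineJet R b₀ b₁ b₂ w θ) = ridgeJet S b₀ b₁ b₂ (w • ξ) θ := by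
    intro b₀ b₁ b₂ w θ
    ext1 z
    refine Prod.ext ?_ (Prod.ext ?_ ?_)
    · simp [T, affineJet, ridgeJet, ridgeMap, ι, real_inner_smul_left]
    · funext i
      simp [T, affineJet, ridgeJet, ridgeMap, ι, real_inner_smul_left]
      ring
    · simp [T, affineJet, ridgeJet, ridgeMap, ι, real_inner_smul_left]
      ring
  have h := affineJet_mem_of_not_polynomial (le_max_right B 0) h₁ h₂ hnp hg₁ hg₂
  have h' := hTa g₀ g₁ g₂ 1 0
  rw [one_smul] at h'
  rw [← h']
  refine map_mem_closure hT h fun u hu => ?_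
  have hle : Submodule.span ℝ (range fun p : ℝ × ℝ => affineJet R a₀ a₁ a₂ p.1 p.2) ≤
      (Submodule.span ℝ (range fun p : E3 × ℝ => ridgeJet S a₀ a₁ a₂ p.1 p.2)).comap T := by
    rw [Submodule.span_le]
    rintro _ ⟨p, rfl⟩
    exact Submodule.subset_span ⟨(p.1 • ξ, p.2), (hTa _ _ _ _ _).symm⟩
  exact hle hu

/-! ### Fourier inversion: smooth functions are superpositions of ridge functions -/

open FourierTransform LineDeriv SchwartzMap in
theorem fourier_lineDerivOp_apply (f : 𝓢(E3, ℂ)) (m ξ : E3) :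
    𝓕 (∂_{m} f) ξ = 2 * Real.pi * Complex.I * (inner ℝ ξ m : ℝ) * 𝓕 f ξ := by
  have hm : (fun x : E3 => inner ℝ x m).HasTemperateGrowth := by fun_prop
  rw [fourier_lineDerivOp_eq]
  simp only [smul_apply, smulLeftCLM_apply_apply hm, smul_eq_mul, Complex.real_smul]
  ring

open FourierTransform SchwartzMap in
theorem schwartz_inversion (f : 𝓢(E3, ℂ)) (z : E3) :
    f z = ∫ ξ, Complex.exp (↑(2 * Real.pi * inner ℝ ξ z) * Complex.I) * 𝓕 f ξ := by
  have h : 𝓕⁻ (𝓕 f) = f := FourierTransform.fourierInv_fourier_eq f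
  conv_lhs => rw [← h]
  rw [fourierInv_coe, Real.fourierInv_eq']
  rfl

open FourierTransform SchwartzMap in
theorem schwartz_inversion_integrable (f : 𝓢(E3, ℂ)) (z : E3) :
    Integrable fun ξ => Complex.exp (↑(2 * Real.pi * inner ℝ ξ z) * Complex.I) * 𝓕 f ξ := by
  refine ((𝓕 f).integrable (μ := volume)).norm.mono' ?_ (Eventually.of_forall fun ξ => ?_)
  · have := (𝓕 f).continuous
    exact Continuous.aestronglyMeasurable (by fun_prop)
  · rw [norm_mul, Complex.norm_exp_ofReal_mul_I, one_mul]

/-- The cosine as a bundled continuous map. -/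
def cosMap : C(ℝ, ℝ) := ⟨Real.cos, Real.continuous_cos⟩

/-- The sine as a bundled continuous map. -/
def sinMap : C(ℝ, ℝ) := ⟨Real.sin, Real.continuous_sin⟩

/-- Quadratic growth in the frequency is harmless against the rapidly decreasing Fourier transform
of a test function, which makes the jet-valued Fourier integral converge. -/
theorem norm_ridgeJet_le {S : Set E3} [CompactSpace S] {g₀ g₁ g₂ : C(ℝ, ℝ)}
    (h₀ : ∀ x, |g₀ x| ≤ 1) (h₁ : ∀ x, |g₁ x| ≤ 1) (h₂ : ∀ x, |g₂ x| ≤ 1) (ξ : E3) (θ : ℝ) :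
    ‖ridgeJet S g₀ g₁ g₂ ξ θ‖ ≤ 1 + ‖ξ‖ + ‖ξ‖ ^ 2 := by
  have hi : ∀ i, |ξ i| ≤ ‖ξ‖ := fun i => PiLp.norm_apply_le ξ i
  have hn := norm_nonneg ξ
  refine (ContinuousMap.norm_le _ (by positivity)).2 fun z => ?_
  simp only [ridgeJet, ContinuousMap.coe_mk, Prod.norm_mk]
  refine max_le ?_ (max_le ((pi_norm_le_iff_of_nonneg (by positivity)).2 fun i => ?_) ?_)
  · have := h₀ (inner ℝ ξ (z : E3) + θ)
    rw [Real.norm_eq_abs]; nlinarith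
  · have := mul_le_mul (hi i) (h₁ (inner ℝ ξ (z : E3) + θ)) (abs_nonneg _) hn
    rw [Real.norm_eq_abs, abs_mul]; nlinarith
  · have h3 : |ξ 2| ^ 2 ≤ ‖ξ‖ ^ 2 := by gcongr; exact hi 2
    have := mul_le_mul h3 (h₂ (inner ℝ ξ (z : E3) + θ)) (abs_nonneg _) (by positivity)
    rw [Real.norm_eq_abs, abs_mul, abs_pow]; nlinarith

-- The real part of Fourier inversion expresses `F` as the integral of `Re (𝓕 f) cos - Im (𝓕 f) sin`
-- in `2π⟪ξ, z⟫`. Inversion applied to the derivatives of `f`, whose transforms carry factors `2πi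
-- ξᵢ`, identifies the remaining jet components, so `J` is a Bochner integral of elements of the
-- closed span.
open FourierTransform LineDeriv SchwartzMap in
theorem smoothJet_mem {S : Set E3} [CompactSpace S] {a₀ a₁ a₂ : C(ℝ, ℝ)}
    (h₁ : ∀ x, HasDerivAt a₀ (a₁ x) x) (h₂ : ∀ x, HasDerivAt a₁ (a₂ x) x)
    (hnp : ¬ ∃ p : Polynomial ℝ, ∀ y, a₀ y = p.eval y)
    {F : E3 → ℝ} (hF : ContDiff ℝ (⊤ : ℕ∞) F) (hFs : HasCompactSupport F)
    {D : Fin 3 → E3 → ℝ} {D₂ : E3 → ℝ}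
    (hD : ∀ i z, HasLineDerivAt ℝ F (D i z) z (EuclideanSpace.single i 1))
    (hD₂ : ∀ z, HasLineDerivAt ℝ (D 2) (D₂ z) z (EuclideanSpace.single 2 1))
    {J : C(S, ℝ × (Fin 3 → ℝ) × ℝ)} (hJ : ∀ z, J z = (F z, fun i => D i z, D₂ z)) :
    J ∈ ridgeSpan S a₀ a₁ a₂ := by
  have hcs : HasCompactSupport (fun z => (F z : ℂ)) := hFs.comp_left Complex.ofReal_zero
  let f : 𝓢(E3, ℂ) := hcs.toSchwartzMap (Complex.ofRealCLM.contDiff.comp hF)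
  have hf : ∀ z, f z = (F z : ℂ) := fun z => rfl
  have hf1 : ∀ i z, (∂_{(EuclideanSpace.single i (1 : ℝ) : E3)} f) z = (D i z : ℂ) := fun i z => by
    rw [lineDerivOp_apply]
    exact HasLineDerivAt.lineDeriv (HasDerivAt.ofReal_comp (hD i z))
  have hf2 : ∀ z, (∂_{(EuclideanSpace.single 2 (1 : ℝ) : E3)}
      (∂_{(EuclideanSpace.single 2 (1 : ℝ) : E3)} f)) z = (D₂ z : ℂ) := fun z => by
    rw [lineDerivOp_apply]
    refine HasLineDerivAt.lineDeriv ?_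
    rw [show ⇑(∂_{(EuclideanSpace.single 2 (1 : ℝ) : E3)} f : 𝓢(E3, ℂ)) = fun z => (D 2 z : ℂ) from
      funext (hf1 2)]
    exact HasDerivAt.ofReal_comp (hD₂ z)
  let A : E3 → C(S, ℝ × (Fin 3 → ℝ) × ℝ) := fun ξ =>
    ridgeJet S cosMap (-sinMap) (-cosMap) ((2 * Real.pi) • ξ) 0
  let B : E3 → C(S, ℝ × (Fin 3 → ℝ) × ℝ) := fun ξ =>
    ridgeJet S sinMap cosMap (-sinMap) ((2 * Real.pi) • ξ) 0
  let h : E3 → C(S, ℝ × (Fin 3 → ℝ) × ℝ) := fun ξ => (𝓕 f ξ).re • A ξ - (𝓕 f ξ).im • B ξ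
  have hA : Continuous A := (continuous_ridgeJet S _ _ _ 0).comp (by fun_prop)
  have hB : Continuous B := (continuous_ridgeJet S _ _ _ 0).comp (by fun_prop)
  have hc : Continuous h := by
    have := (𝓕 f).continuous
    exact ((Complex.continuous_re.comp this).smul hA).sub ((Complex.continuous_im.comp this).smul hB)
  have hint : Integrable h := by
    have hb := ((((𝓕 f).integrable_pow_mul volume 0).const_mul 2).add
      (((𝓕 f).integrable_pow_mul volume 1).const_mul (2 * (2 * Real.pi)))).add
      (((𝓕 f).integrable_pow_mul volume 2).const_mul (2 * (2 * Real.pi) ^ 2))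
    refine hb.mono' hc.aestronglyMeasurable (Eventually.of_forall fun ξ => ?_)
    have hAn : ‖A ξ‖ ≤ _ := norm_ridgeJet_le (fun x => Real.abs_cos_le_one x)
      (fun x => by simpa [sinMap] using Real.abs_sin_le_one x)
      (fun x => by simpa [cosMap] using Real.abs_cos_le_one x) _ _
    have hBn : ‖B ξ‖ ≤ _ := norm_ridgeJet_le (fun x => Real.abs_sin_le_one x)
      (fun x => Real.abs_cos_le_one x)
      (fun x => by simpa [sinMap] using Real.abs_sin_le_one x) _ _
    have e1 : ‖(𝓕 f ξ).re • A ξ‖ ≤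
        ‖𝓕 f ξ‖ * (1 + ‖(2 * Real.pi) • ξ‖ + ‖(2 * Real.pi) • ξ‖ ^ 2) := by
      rw [norm_smul]
      exact mul_le_mul (Complex.abs_re_le_norm _) hAn (norm_nonneg _) (norm_nonneg _)
    have e2 : ‖(𝓕 f ξ).im • B ξ‖ ≤
        ‖𝓕 f ξ‖ * (1 + ‖(2 * Real.pi) • ξ‖ + ‖(2 * Real.pi) • ξ‖ ^ 2) := by
      rw [norm_smul]
      exact mul_le_mul (Complex.abs_im_le_norm _) hBn (norm_nonneg _) (norm_nonneg _)
    refine (norm_sub_le _ _).trans ((add_le_add e1 e2).trans (le_of_eq ?_))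
    have hpi : |Real.pi| = Real.pi := abs_of_pos Real.pi_pos
    simp [norm_smul, hpi]
    ring
  have hmem : ∀ ξ, h ξ ∈ ridgeSpan S a₀ a₁ a₂ := fun ξ =>
    Submodule.sub_mem _
      (Submodule.smul_mem _ _ (ridgeJet_mem h₁ h₂ hnp (fun x => Real.hasDerivAt_cos x)
        (fun x => (Real.hasDerivAt_sin x).neg) _))
      (Submodule.smul_mem _ _ (ridgeJet_mem h₁ h₂ hnp (fun x => Real.hasDerivAt_sin x)
        (fun x => Real.hasDerivAt_cos x) _))
  have hin : ∀ (ξ : E3) i, inner ℝ ξ (EuclideanSpace.single i (1 : ℝ)) = ξ i := fun ξ i => by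
    simp [EuclideanSpace.inner_single_right]
  have key : J = ∫ ξ, h ξ := by
    ext1 z
    have hev := (ContinuousMap.evalCLM ℝ z).integral_comp_comm hint
    simp only [ContinuousMap.evalCLM_apply] at hev
    have hs : Integrable fun ξ => h ξ z := (ContinuousMap.evalCLM ℝ z).integrable_comp hint
    have hre : ∀ g : 𝓢(E3, ℂ), (g z).re = ∫ ξ, (Complex.exp
        (↑(2 * Real.pi * inner ℝ ξ (z : E3)) * Complex.I) * 𝓕 g ξ).re := fun g => by
      rw [schwartz_inversion g z]
      exact (Complex.reCLM.integral_comp_comm (schwartz_inversion_integrable g z)).symm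
    rw [← hev, hJ]
    refine Prod.ext ?_ (Prod.ext ?_ ?_)
    · rw [fst_integral hs]
      have := hre f
      rw [hf, Complex.ofReal_re] at this
      rw [this]
      refine integral_congr_ae (Eventually.of_forall fun ξ => ?_)
      beta_reduce
      rw [Complex.mul_re, Complex.exp_ofReal_mul_I_re, Complex.exp_ofReal_mul_I_im]
      simp [h, A, B, ridgeJet, real_inner_smul_left, cosMap, sinMap]
      ring
    · funext i
      have hp := ((ContinuousLinearMap.proj (R := ℝ) (φ := fun _ : Fin 3 => ℝ) i).comp
        ((ContinuousLinearMap.fst ℝ (Fin 3 → ℝ) ℝ).comp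
        (ContinuousLinearMap.snd ℝ ℝ ((Fin 3 → ℝ) × ℝ)))).integral_comp_comm hs
      refine Eq.trans ?_ hp
      have := hre (∂_{(EuclideanSpace.single i (1 : ℝ) : E3)} f)
      rw [hf1, Complex.ofReal_re] at this
      refine Eq.trans this ?_
      refine integral_congr_ae (Eventually.of_forall fun ξ => ?_)
      beta_reduce
      rw [fourier_lineDerivOp_apply, hin, Complex.mul_re, Complex.exp_ofReal_mul_I_re,
        Complex.exp_ofReal_mul_I_im]
      simp [h, A, B, ridgeJet, real_inner_smul_left, cosMap, sinMap]
      ring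
    · have hp := ((ContinuousLinearMap.snd ℝ (Fin 3 → ℝ) ℝ).comp
        (ContinuousLinearMap.snd ℝ ℝ ((Fin 3 → ℝ) × ℝ))).integral_comp_comm hs
      refine Eq.trans ?_ hp
      have := hre (∂_{(EuclideanSpace.single 2 (1 : ℝ) : E3)}
        (∂_{(EuclideanSpace.single 2 (1 : ℝ) : E3)} f))
      rw [hf2, Complex.ofReal_re] at this
      rw [this]
      refine integral_congr_ae (Eventually.of_forall fun ξ => ?_)
      beta_reduce
      rw [fourier_lineDerivOp_apply, fourier_lineDerivOp_apply, hin, Complex.mul_re,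
        Complex.exp_ofReal_mul_I_re, Complex.exp_ofReal_mul_I_im]
      simp [h, A, B, ridgeJet, real_inner_smul_left, cosMap, sinMap]
      ring
  rw [key]
  exact integral_mem_of_isClosed (Submodule.isClosed_topologicalClosure _) hint hmem

/-! ### Cutoff and mollification -/

theorem hasLineDerivAt_cutoff {χ G G' : E3 → ℝ} {Ω : Set E3} {v : E3}
    (hχ : ContDiff ℝ (⊤ : ℕ∞) χ) (hsupp : tsupport χ ⊆ Ω)
    (hG : ∀ z ∈ Ω, HasLineDerivAt ℝ G (G' z) z v) (z : E3) :
    HasLineDerivAt ℝ (fun y => χ y * G y) (fderiv ℝ χ z v * G z + χ z * G' z) z v := by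
  have hχd : HasLineDerivAt ℝ χ (fderiv ℝ χ z v) z v :=
    (hχ.differentiable (by simp) z).hasFDerivAt.hasLineDerivAt v
  by_cases hz : z ∈ Ω
  · have := HasDerivAt.fun_mul hχd (hG z hz)
    simpa [HasLineDerivAt] using this
  -- Outside `Ω` nothing is known about `G` or `G'`, but the product vanishes in a neighbourhood of
  -- `z`.
  · have hz' : z ∉ tsupport χ := fun h => hz (hsupp h)
    have h0 := notMem_tsupport_iff_eventuallyEq.1 hz'
    have h1 : fderiv ℝ χ z = 0 := by rw [h0.fderiv_eq]; simp
    have h2 : (fun y => χ y * G y) =ᶠ[𝓝 z] fun _ => (0 : ℝ) := by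
      filter_upwards [h0] with y hy
      simp [hy]
    rw [h1, image_eq_zero_of_notMem_tsupport hz']
    simp only [zero_apply, zero_mul, add_zero]
    exact (h2.hasLineDerivAt_iff).2 (by simp [HasLineDerivAt, hasDerivAt_const])

theorem continuous_cutoff {χ G : E3 → ℝ} {Ω : Set E3} (hΩ : IsOpen Ω) (hχ : Continuous χ)
    (hsupp : tsupport χ ⊆ Ω) (hG : ContinuousOn G Ω) : Continuous fun y => χ y * G y :=
  (hχ.continuousOn.mul hG).continuous_of_tsupport_subset hΩ
    ((tsupport_mul_subset_left (f := χ) (g := G)).trans hsupp)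

theorem exists_smooth_cutoff {S Ω : Set E3} (hS : IsCompact S) (hΩ : IsOpen Ω) (hSΩ : S ⊆ Ω) :
    ∃ χ : E3 → ℝ, ContDiff ℝ (⊤ : ℕ∞) χ ∧ HasCompactSupport χ ∧ tsupport χ ⊆ Ω ∧
      ∀ z ∈ S, ∀ᶠ y in 𝓝 z, χ y = 1 := by
  obtain ⟨L, hL, hSL, hLΩ⟩ := exists_compact_between hS hΩ hSΩ
  obtain ⟨χ, h1, h0, -⟩ := exists_contMDiffMap_one_nhds_of_subset_interior
    (n := (⊤ : ℕ∞)) (modelWithCornersSelf ℝ E3) hS.isClosed hSL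
  have hsub : tsupport χ ⊆ L := closure_minimal (fun x hx => by
    by_contra h; exact hx (h0 x h)) hL.isClosed
  exact ⟨χ, χ.contMDiff.contDiff, hL.of_isClosed_subset (isClosed_tsupport _) hsub,
    hsub.trans hLΩ, fun z hz => eventually_nhdsSet_iff_forall.1 h1 z hz⟩

theorem eventually_conv_near {g : E3 → ℝ} (hg : Continuous g) (hgs : HasCompactSupport g)
    {ε : ℝ} (hε : 0 < ε) :
    ∀ᶠ n in atTop, ∀ z, |conv volume ((shrinkingBump E3 n).normed volume) g z - g z| ≤ ε := by
  obtain ⟨δ, hδ, h⟩ := Metric.uniformContinuous_iff.1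
    (hg.uniformContinuous_of_tendsto_cocompact hgs.is_zero_at_infty) ε hε
  have hB : Tendsto (fun n => (shrinkingBump E3 n).rOut) atTop (𝓝 0) :=
    tendsto_one_div_add_atTop_nhds_zero_nat
  filter_upwards [hB.eventually (gt_mem_nhds hδ)] with n hn z
  have := (shrinkingBump E3 n).dist_normed_convolution_le (μ := volume) (g := g) (x₀ := z)
    (ε := ε) hg.aestronglyMeasurable (fun x hx => (h (lt_trans hx hn)).le)
  exact this

/-- A function with continuous first derivatives and continuous second derivative in the last
coordinate, near a compact set, is approximated in the corresponding norm by test functions. -/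
theorem exists_smooth_near {S Ω : Set E3} (hS : IsCompact S) (hΩ : IsOpen Ω) (hSΩ : S ⊆ Ω)
    {G D₂ : E3 → ℝ} {D : Fin 3 → E3 → ℝ} (hG : ContinuousOn G Ω)
    (hDc : ∀ i, ContinuousOn (D i) Ω) (hD₂c : ContinuousOn D₂ Ω)
    (hD : ∀ i, ∀ z ∈ Ω, HasLineDerivAt ℝ G (D i z) z (EuclideanSpace.single i 1))
    (hD₂ : ∀ z ∈ Ω, HasLineDerivAt ℝ (D 2) (D₂ z) z (EuclideanSpace.single 2 1))
    {ε : ℝ} (hε : 0 < ε) :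
    ∃ (F : E3 → ℝ) (F' : Fin 3 → E3 → ℝ) (F₂ : E3 → ℝ),
      ContDiff ℝ (⊤ : ℕ∞) F ∧ HasCompactSupport F ∧
      (∀ i z, HasLineDerivAt ℝ F (F' i z) z (EuclideanSpace.single i 1)) ∧
      (∀ z, HasLineDerivAt ℝ (F' 2) (F₂ z) z (EuclideanSpace.single 2 1)) ∧
      ∀ z ∈ S, |F z - G z| ≤ ε ∧ (∀ i, |F' i z - D i z| ≤ ε) ∧ |F₂ z - D₂ z| ≤ ε := by
  obtain ⟨χ, hχ, hχs, hχΩ, hχ1⟩ := exists_smooth_cutoff hS hΩ hSΩ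
  let e : Fin 3 → E3 := fun i => EuclideanSpace.single i 1
  let dχ : Fin 3 → E3 → ℝ := fun i z => fderiv ℝ χ z (e i)
  have hdχ : ∀ i, ContDiff ℝ (⊤ : ℕ∞) (dχ i) := fun i =>
    (hχ.fderiv_right (m := (⊤ : ℕ∞)) (by simp)).clm_apply contDiff_const
  have hdχΩ : ∀ i, tsupport (dχ i) ⊆ Ω := fun i => (tsupport_fderiv_apply_subset ℝ (e i)).trans hχΩ
  have hdχs : ∀ i, HasCompactSupport (dχ i) := fun i => hχs.fderiv_apply ℝ (e i)
  let ddχ : E3 → ℝ := fun z => fderiv ℝ (dχ 2) z (e 2)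
  have hddχc : Continuous ddχ :=
    ((hdχ 2).fderiv_right (m := 0) (by simp)).continuous.clm_apply continuous_const
  have hddχΩ : tsupport ddχ ⊆ Ω := (tsupport_fderiv_apply_subset ℝ (e 2)).trans (hdχΩ 2)
  have hddχs : HasCompactSupport ddχ := (hdχs 2).fderiv_apply ℝ (e 2)
  -- `Q` and `Q₂` are the product-rule derivatives of `P`. Only these directional derivatives are
  -- available, and they suffice, because convolution commutes with each of them separately.
  let P : E3 → ℝ := fun z => χ z * G z
  let Q : Fin 3 → E3 → ℝ := fun i z => dχ i z * G z + χ z * D i z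
  let Q₂ : E3 → ℝ := fun z => (ddχ z * G z + dχ 2 z * D 2 z) + (dχ 2 z * D 2 z + χ z * D₂ z)
  have hP : Continuous P := continuous_cutoff hΩ hχ.continuous hχΩ hG
  have hQ : ∀ i, Continuous (Q i) := fun i =>
    (continuous_cutoff hΩ (hdχ i).continuous (hdχΩ i) hG).add
      (continuous_cutoff hΩ hχ.continuous hχΩ (hDc i))
  have hQ₂ : Continuous Q₂ :=
    ((continuous_cutoff hΩ hddχc hddχΩ hG).add
      (continuous_cutoff hΩ (hdχ 2).continuous (hdχΩ 2) (hDc 2))).add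
    ((continuous_cutoff hΩ (hdχ 2).continuous (hdχΩ 2) (hDc 2)).add
      (continuous_cutoff hΩ hχ.continuous hχΩ hD₂c))
  have hPs : HasCompactSupport P := hχs.mul_right
  have hQs : ∀ i, HasCompactSupport (Q i) := fun i => (hdχs i).mul_right.add hχs.mul_right
  have hQ₂s : HasCompactSupport Q₂ :=
    (hddχs.mul_right.add (hdχs 2).mul_right).add ((hdχs 2).mul_right.add hχs.mul_right)
  have hPQ : ∀ i z, HasLineDerivAt ℝ P (Q i z) z (e i) := fun i =>
    hasLineDerivAt_cutoff hχ hχΩ (hD i)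
  have hQQ : ∀ z, HasLineDerivAt ℝ (Q 2) (Q₂ z) z (e 2) := fun z =>
    HasDerivAt.add (hasLineDerivAt_cutoff (hdχ 2) (hdχΩ 2) (hD 2) z)
      (hasLineDerivAt_cutoff hχ hχΩ hD₂ z)
  have hev := ((eventually_conv_near hP hPs hε).and
    ((eventually_all.2 fun i => eventually_conv_near (hQ i) (hQs i) hε).and
      (eventually_conv_near hQ₂ hQ₂s hε))).exists
  obtain ⟨n, hn0, hn1, hn2⟩ := hev
  set φ := (shrinkingBump E3 n).normed volume with hφdef
  have hφ : ContDiff ℝ (⊤ : ℕ∞) φ := (shrinkingBump E3 n).contDiff_normed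
  have hφs : HasCompactSupport φ := (shrinkingBump E3 n).hasCompactSupport_normed
  refine ⟨conv volume φ P, fun i => conv volume φ (Q i), conv volume φ Q₂,
    contDiff_conv hφ hφs hP, HasCompactSupport.convolution (L := ContinuousLinearMap.mul ℝ ℝ)
      (μ := volume) hφs hPs,
    fun i => hasLineDerivAt_conv hφ.continuous hφs hP (hQ i) (hPQ i),
    hasLineDerivAt_conv hφ.continuous hφs (hQ 2) hQ₂ hQQ, fun z hz => ?_⟩
  have hx := hχ1 z hz
  have hx0 : χ z = 1 := hx.self_of_nhds
  -- Since `χ = 1` near `z`, and not merely at `z`, its first and second derivatives vanish there,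
  -- and `P`, `Q`, `Q₂` agree with `G`, `D`, `D₂` at `z`.
  have hd : ∀ i, ∀ᶠ y in 𝓝 z, dχ i y = 0 := fun i => by
    filter_upwards [eventually_eventually_nhds.2 hx] with y hy
    have : fderiv ℝ χ y = 0 := by
      rw [EventuallyEq.fderiv_eq (show χ =ᶠ[𝓝 y] fun _ => 1 from hy)]; simp
    simp [dχ, this]
  have hd0 : ∀ i, dχ i z = 0 := fun i => (hd i).self_of_nhds
  have hdd : ddχ z = 0 := by
    have : fderiv ℝ (dχ 2) z = 0 := by
      rw [EventuallyEq.fderiv_eq (show dχ 2 =ᶠ[𝓝 z] fun _ => 0 from hd 2)]; simp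
    simp [ddχ, this]
  refine ⟨by simpa [P, hx0] using hn0 z, fun i => by simpa [Q, hx0, hd0] using hn1 i z,
    by simpa [Q₂, hx0, hd0, hdd] using hn2 z⟩

/-! ### Finite sums of ridge functions and networks -/

/-- The function `∑ⱼ cⱼ g(wⱼ · (t, x, v) + θⱼ)`. -/
def ridgeSum {n : ℕ} (g : ℝ → ℝ) (c : Fin n → ℝ) (w : Fin n → E3) (θ : Fin n → ℝ)
    (t x v : ℝ) : ℝ :=
  ∑ j, c j * g (w j 0 * t + w j 1 * x + w j 2 * v + θ j)

section ridgeSum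

theorem hasDerivAt_affine (a b s : ℝ) : HasDerivAt (fun r => a * r + b) a s := by
  simpa using ((hasDerivAt_id' s).const_mul a).add_const b

variable {n : ℕ} {g g' : ℝ → ℝ}

theorem hasDerivAt_ridgeSum_time (hg : ∀ x, HasDerivAt g (g' x) x) (c : Fin n → ℝ)
    (w : Fin n → E3) (θ : Fin n → ℝ) (t x v : ℝ) :
    HasDerivAt (fun s => ridgeSum g c w θ s x v)
      (ridgeSum g' (fun j => c j * w j 0) w θ t x v) t := by
  refine HasDerivAt.fun_sum fun j _ => ?_
  have h : HasDerivAt (fun s => w j 0 * s + w j 1 * x + w j 2 * v + θ j) (w j 0) t :=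
    (hasDerivAt_affine (w j 0) (w j 1 * x + w j 2 * v + θ j) t).congr_of_eventuallyEq
      (Eventually.of_forall fun _ => by ring)
  exact (((hg _).comp t h).const_mul (c j)).congr_deriv (by ring)

theorem hasDerivAt_ridgeSum_space (hg : ∀ x, HasDerivAt g (g' x) x) (c : Fin n → ℝ)
    (w : Fin n → E3) (θ : Fin n → ℝ) (t x v : ℝ) :
    HasDerivAt (fun y => ridgeSum g c w θ t y v)
      (ridgeSum g' (fun j => c j * w j 1) w θ t x v) x := by
  refine HasDerivAt.fun_sum fun j _ => ?_
  have h : HasDerivAt (fun y => w j 0 * t + w j 1 * y + w j 2 * v + θ j) (w j 1) x :=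
    (hasDerivAt_affine (w j 1) (w j 0 * t + w j 2 * v + θ j) x).congr_of_eventuallyEq
      (Eventually.of_forall fun _ => by ring)
  exact (((hg _).comp x h).const_mul (c j)).congr_deriv (by ring)

theorem hasDerivAt_ridgeSum_velocity (hg : ∀ x, HasDerivAt g (g' x) x) (c : Fin n → ℝ)
    (w : Fin n → E3) (θ : Fin n → ℝ) (t x v : ℝ) :
    HasDerivAt (fun u => ridgeSum g c w θ t x u)
      (ridgeSum g' (fun j => c j * w j 2) w θ t x v) v := by
  refine HasDerivAt.fun_sum fun j _ => ?_
  have h : HasDerivAt (fun u => w j 0 * t + w j 1 * x + w j 2 * u + θ j) (w j 2) v :=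
    (hasDerivAt_affine (w j 2) (w j 0 * t + w j 1 * x + θ j) v).congr_of_eventuallyEq
      (Eventually.of_forall fun _ => by ring)
  exact (((hg _).comp v h).const_mul (c j)).congr_deriv (by ring)

theorem continuous_ridgeSum (hg : Continuous g) (c : Fin n → ℝ) (w : Fin n → E3)
    (θ : Fin n → ℝ) :
    Continuous fun q : ℝ × ℝ × ℝ => ridgeSum g c w θ q.1 q.2.1 q.2.2 := by
  unfold ridgeSum
  fun_prop

end ridgeSum

theorem exists_ridgeSum_near {S : Set E3} [CompactSpace S] {a₀ a₁ a₂ : C(ℝ, ℝ)}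
    {J : C(S, ℝ × (Fin 3 → ℝ) × ℝ)} (hJ : J ∈ ridgeSpan S a₀ a₁ a₂) {ε : ℝ} (hε : 0 < ε) :
    ∃ (n : ℕ) (c : Fin n → ℝ) (w : Fin n → E3) (θ : Fin n → ℝ), ∀ z : S,
      |ridgeSum a₀ c w θ ((z : E3) 0) ((z : E3) 1) ((z : E3) 2) - (J z).1| ≤ ε ∧
      (∀ i, |ridgeSum a₁ (fun j => c j * w j i) w θ ((z : E3) 0) ((z : E3) 1) ((z : E3) 2)
        - (J z).2.1 i| ≤ ε) ∧
      |ridgeSum a₂ (fun j => c j * w j 2 * w j 2) w θ ((z : E3) 0) ((z : E3) 1) ((z : E3) 2)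
        - (J z).2.2| ≤ ε := by
  obtain ⟨u, hu, hd⟩ := Metric.mem_closure_iff.1 hJ ε hε
  obtain ⟨n, c, q, rfl⟩ := Submodule.mem_span_set'.1 hu
  choose p hp using fun j => (q j).2
  refine ⟨n, c, fun j => (p j).1, fun j => (p j).2, fun z => ?_⟩
  have hz := (ContinuousMap.dist_apply_le_dist z).trans hd.le
  have hq : ∀ j, ((q j : C(S, ℝ × (Fin 3 → ℝ) × ℝ)) z) =
      ridgeJet S a₀ a₁ a₂ (p j).1 (p j).2 z := fun j => by rw [← hp j]
  have hin : ∀ j, inner ℝ (p j).1 (z : E3) + (p j).2 =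
      (p j).1 0 * (z : E3) 0 + (p j).1 1 * (z : E3) 1 + (p j).1 2 * (z : E3) 2 + (p j).2 :=
    fun j => by simp [PiLp.inner_apply, Fin.sum_univ_three, mul_comm]
  have hsum : ((∑ j, c j • (q j : C(S, ℝ × (Fin 3 → ℝ) × ℝ))) : C(S, ℝ × (Fin 3 → ℝ) × ℝ)) z =
      ∑ j, c j • ridgeJet S a₀ a₁ a₂ (p j).1 (p j).2 z := by
    simp [ContinuousMap.sum_apply, hq]
  rw [hsum, dist_comm, Prod.dist_eq, max_le_iff, Prod.dist_eq, max_le_iff] at hz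
  obtain ⟨h0, h1, h2⟩ := hz
  refine ⟨?_, fun i => ?_, ?_⟩
  · rw [Real.dist_eq, Prod.fst_sum] at h0
    simpa [ridgeSum, ridgeJet, hin] using h0
  · have h1' := (dist_le_pi_dist _ _ i).trans h1
    rw [Real.dist_eq, Prod.snd_sum, Prod.fst_sum, Finset.sum_apply] at h1'
    simpa [ridgeSum, ridgeJet, hin, mul_assoc] using h1'
  · rw [Real.dist_eq, Prod.snd_sum, Prod.snd_sum] at h2
    simpa [ridgeSum, ridgeJet, hin, mul_assoc, sq] using h2

/-- Two sums of ridge functions are the two outputs of one network. -/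
theorem exists_params_of_ridgeSum (act : ℝ → ℝ) {n k : ℕ} (c : Fin n → ℝ) (w : Fin n → E3)
    (θ : Fin n → ℝ) (d : Fin k → ℝ) (y : Fin k → E3) (η : Fin k → ℝ) :
    ∃ p : Params (n + k), p.fnn act = ridgeSum act c w θ ∧ p.hnn act = ridgeSum act d y η := by
  -- The hidden layers are placed side by side, and each output has zero weights on the other's
  -- block.
  refine ⟨⟨fun j i => Fin.append w y j i, Fin.append θ η,
    ![Fin.append c 0, Fin.append 0 d], 0⟩, ?_, ?_⟩
  · funext t x v
    simp [Params.fnn, Params.output, ridgeSum, Fin.sum_univ_add, Fin.sum_univ_three]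
  · funext t x v
    simp [Params.hnn, Params.output, ridgeSum, Fin.sum_univ_add, Fin.sum_univ_three]

/-- Sums of ridge functions with a non-polynomial profile approximate test functions. -/
theorem exists_ridgeSum_near_smooth {S : Set E3} (hS : IsCompact S) {a₀ a₁ a₂ : C(ℝ, ℝ)}
    (h₁ : ∀ x, HasDerivAt a₀ (a₁ x) x) (h₂ : ∀ x, HasDerivAt a₁ (a₂ x) x)
    (hnp : ¬ ∃ p : Polynomial ℝ, ∀ y, a₀ y = p.eval y)
    {F : E3 → ℝ} (hF : ContDiff ℝ (⊤ : ℕ∞) F) (hFs : HasCompactSupport F)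
    {ε : ℝ} (hε : 0 < ε) :
    ∃ (n : ℕ) (c : Fin n → ℝ) (w : Fin n → E3) (θ : Fin n → ℝ), ∀ z ∈ S,
      |ridgeSum a₀ c w θ (z 0) (z 1) (z 2) - F z| ≤ ε ∧
      (∀ i, |ridgeSum a₁ (fun j => c j * w j i) w θ (z 0) (z 1) (z 2)
        - fderiv ℝ F z (EuclideanSpace.single i 1)| ≤ ε) ∧
      |ridgeSum a₂ (fun j => c j * w j 2 * w j 2) w θ (z 0) (z 1) (z 2)
        - fderiv ℝ (fun y => fderiv ℝ F y (EuclideanSpace.single 2 1)) z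
          (EuclideanSpace.single 2 1)| ≤ ε := by
  have hcs : CompactSpace S := isCompact_iff_compactSpace.1 hS
  have hd : ∀ i : Fin 3, ContDiff ℝ (⊤ : ℕ∞)
      fun z => fderiv ℝ F z (EuclideanSpace.single i (1 : ℝ)) := fun i =>
    (hF.fderiv_right (m := (⊤ : ℕ∞)) (by simp)).clm_apply contDiff_const
  have hd2 : Continuous fun z => fderiv ℝ (fun y => fderiv ℝ F y
      (EuclideanSpace.single (2 : Fin 3) (1 : ℝ))) z (EuclideanSpace.single 2 1) :=
    ((hd 2).fderiv_right (m := 0) (by simp)).continuous.clm_apply continuous_const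
  let J : C(S, ℝ × (Fin 3 → ℝ) × ℝ) := ⟨fun z => (F z,
    fun i => fderiv ℝ F z (EuclideanSpace.single i 1),
    fderiv ℝ (fun y => fderiv ℝ F y (EuclideanSpace.single 2 1)) z (EuclideanSpace.single 2 1)),
    (hF.continuous.comp continuous_subtype_val).prodMk
      ((continuous_pi fun i => (hd i).continuous.comp continuous_subtype_val).prodMk
        (hd2.comp continuous_subtype_val))⟩
  have hJ : J ∈ ridgeSpan S a₀ a₁ a₂ := smoothJet_mem h₁ h₂ hnp hF hFs
    (fun i z => (hF.differentiable (by simp) z).hasFDerivAt.hasLineDerivAt _)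
    (fun z => ((hd 2).differentiable (by simp) z).hasFDerivAt.hasLineDerivAt _)
    (fun z => rfl)
  obtain ⟨n, c, w, θ, h⟩ := exists_ridgeSum_near hJ hε
  exact ⟨n, c, w, θ, fun z hz => h ⟨z, hz⟩⟩

/-- Simultaneous approximation of a function with its derivatives, and of its last partial
derivative with one more derivative. -/
theorem exists_ridgeSum_pair_near {S Ω : Set E3} (hS : IsCompact S) (hΩ : IsOpen Ω)
    (hSΩ : S ⊆ Ω) {a₀ a₁ a₂ : C(ℝ, ℝ)}
    (h₁ : ∀ x, HasDerivAt a₀ (a₁ x) x) (h₂ : ∀ x, HasDerivAt a₁ (a₂ x) x)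
    (hnp : ¬ ∃ p : Polynomial ℝ, ∀ y, a₀ y = p.eval y)
    {G D₂ : E3 → ℝ} {D : Fin 3 → E3 → ℝ} (hG : ContinuousOn G Ω)
    (hDc : ∀ i, ContinuousOn (D i) Ω) (hD₂c : ContinuousOn D₂ Ω)
    (hD : ∀ i, ∀ z ∈ Ω, HasLineDerivAt ℝ G (D i z) z (EuclideanSpace.single i 1))
    (hD₂ : ∀ z ∈ Ω, HasLineDerivAt ℝ (D 2) (D₂ z) z (EuclideanSpace.single 2 1))
    {ε : ℝ} (hε : 0 < ε) :
    ∃ (n : ℕ) (c : Fin n → ℝ) (w : Fin n → E3) (θ : Fin n → ℝ)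
      (k : ℕ) (d : Fin k → ℝ) (y : Fin k → E3) (η : Fin k → ℝ), ∀ z ∈ S,
      |ridgeSum a₀ c w θ (z 0) (z 1) (z 2) - G z| ≤ ε ∧
      (∀ i, |ridgeSum a₁ (fun j => c j * w j i) w θ (z 0) (z 1) (z 2) - D i z| ≤ ε) ∧
      |ridgeSum a₂ (fun j => c j * w j 2 * w j 2) w θ (z 0) (z 1) (z 2) - D₂ z| ≤ ε ∧
      |ridgeSum a₀ d y η (z 0) (z 1) (z 2) - D 2 z| ≤ ε ∧
      |ridgeSum a₁ (fun j => d j * y j 2) y η (z 0) (z 1) (z 2) - D₂ z| ≤ ε := by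
  obtain ⟨F, F', F₂, hF, hFs, hF', hF₂, hnear⟩ :=
    exists_smooth_near hS hΩ hSΩ hG hDc hD₂c hD hD₂ (half_pos hε)
  have e1 : ∀ i z, fderiv ℝ F z (EuclideanSpace.single i 1) = F' i z := fun i z =>
    ((hF.differentiable (by simp) z).hasFDerivAt.hasLineDerivAt _).unique (hF' i z)
  have e1' : (fun z => fderiv ℝ F z (EuclideanSpace.single 2 1)) = F' 2 := funext (e1 2)
  have hF'2 : ContDiff ℝ (⊤ : ℕ∞) (F' 2) := by
    rw [← e1']
    exact (hF.fderiv_right (m := (⊤ : ℕ∞)) (by simp)).clm_apply contDiff_const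
  have hF's : HasCompactSupport (F' 2) := by
    rw [← e1']
    exact hFs.fderiv_apply ℝ _
  have e2 : ∀ z, fderiv ℝ (F' 2) z (EuclideanSpace.single 2 1) = F₂ z := fun z =>
    ((hF'2.differentiable (by simp) z).hasFDerivAt.hasLineDerivAt _).unique (hF₂ z)
  obtain ⟨n, c, w, θ, hn⟩ := exists_ridgeSum_near_smooth hS h₁ h₂ hnp hF hFs (half_pos hε)
  -- The velocity derivative of the mollified `F` is again a test function, so no third derivative
  -- of `G` is needed.
  obtain ⟨k, d, y, η, hk⟩ := exists_ridgeSum_near_smooth hS h₁ h₂ hnp hF'2 hF's (half_pos hε)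
  refine ⟨n, c, w, θ, k, d, y, η, fun z hz => ?_⟩
  obtain ⟨m0, m1, m2⟩ := hnear z hz
  obtain ⟨n0, n1, n2⟩ := hn z hz
  obtain ⟨k0, k1, -⟩ := hk z hz
  have k1 := k1 2
  rw [e1', e2] at n2
  rw [e2] at k1
  have tri : ∀ {a b c : ℝ}, |a - b| ≤ ε / 2 → |b - c| ≤ ε / 2 → |a - c| ≤ ε := fun h h' =>
    (abs_sub_le _ _ _).trans ((add_le_add h h').trans (add_halves ε).le)
  exact ⟨tri n0 m0, fun i => tri (e1 i z ▸ n1 i) (m1 i), tri n2 m2, tri k0 (m1 2), tri k1 m2⟩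

/-! ### Mass of a continuously differentiable density -/

theorem hasDerivAt_setIntegral {k : Set ℝ} (hk : IsCompact k) {g g' : ℝ → ℝ → ℝ}
    (hg : Continuous fun q : ℝ × ℝ => g q.1 q.2) (hg' : Continuous fun q : ℝ × ℝ => g' q.1 q.2)
    (h : ∀ s x, HasDerivAt (fun r => g r x) (g' s x) s) (s : ℝ) :
    HasDerivAt (fun r => ∫ x in k, g r x) (∫ x in k, g' s x) s := by
  obtain ⟨C, hC⟩ := ((isCompact_Icc (a := s - 1) (b := s + 1)).prod hk).exists_bound_of_continuousOn
    hg'.continuousOn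
  have hi : ∀ {u : ℝ → ℝ → ℝ}, (Continuous fun q : ℝ × ℝ => u q.1 q.2) → ∀ r,
      IntegrableOn (fun x => u r x) k := fun hu r =>
    (hu.comp (by fun_prop : Continuous fun x : ℝ => (r, x))).continuousOn.integrableOn_compact hk
  refine (hasDerivAt_integral_of_dominated_loc_of_deriv_le (μ := volume.restrict k)
    (F := g) (F' := g') (x₀ := s) (s := Icc (s - 1) (s + 1)) (bound := fun _ => C)
    (Icc_mem_nhds (by linarith) (by linarith))
    (Eventually.of_forall fun r => (hi hg r).aestronglyMeasurable) (hi hg s)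
    (hi hg' s).aestronglyMeasurable ?_ ?_ (Eventually.of_forall fun x r _ => h r x)).2
  · exact (ae_restrict_mem hk.measurableSet).mono fun x hx r hr => hC (r, x) ⟨hr, hx⟩
  · exact integrableOn_const hk.measure_lt_top.ne

theorem isCompact_V : IsCompact V := isCompact_Icc

theorem deriv_mass {F Ft : ℝ → ℝ → ℝ → ℝ}
    (hF : Continuous fun q : ℝ × ℝ × ℝ => F q.1 q.2.1 q.2.2)
    (hFt : Continuous fun q : ℝ × ℝ × ℝ => Ft q.1 q.2.1 q.2.2)
    (h : ∀ t x v, HasDerivAt (fun s => F s x v) (Ft t x v) t) (t : ℝ) :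
    deriv (fun s => ∫ x in Ioo (-1 : ℝ) 1, ∫ v in V, F s x v) t =
      ∫ x in Ioo (-1 : ℝ) 1, ∫ v in V, Ft t x v := by
  have hc : ∀ {u : ℝ → ℝ → ℝ → ℝ}, (Continuous fun q : ℝ × ℝ × ℝ => u q.1 q.2.1 q.2.2) →
      Continuous fun q : ℝ × ℝ => ∫ v in V, u q.1 q.2 v := fun {u} hu =>
    continuous_parametric_integral_of_continuous (μ := volume)
      (f := fun (q : ℝ × ℝ) v => u q.1 q.2 v) (hu.comp (by fun_prop : Continuous fun r : (ℝ × ℝ) × ℝ => (r.1.1, r.1.2, r.2))) isCompact_V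
  -- Passing to the closed interval gives a compact domain, on which continuity supplies the
  -- dominating constant.
  simp only [← integral_Icc_eq_integral_Ioo]
  refine (hasDerivAt_setIntegral (g := fun s x => ∫ v in V, F s x v)
    (g' := fun s x => ∫ v in V, Ft s x v) isCompact_Icc (hc hF) (hc hFt) (fun s x => ?_) t).deriv
  exact hasDerivAt_setIntegral isCompact_V
    (hF.comp (by fun_prop : Continuous fun r : ℝ × ℝ => (r.1, x, r.2)))
    (hFt.comp (by fun_prop : Continuous fun r : ℝ × ℝ => (r.1, x, r.2))) (fun r v => h r x v) s

/-! ### Bounds for iterated integrals -/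

theorem volume_real_V : volume.real V = 20 := by
  simp [V, Real.volume_real_Icc]; norm_num

theorem norm_setIntegral_V_le {g : ℝ → ℝ} {B : ℝ} (h : ∀ v ∈ V, ‖g v‖ ≤ B) :
    ‖∫ v in V, g v‖ ≤ 20 * B := by
  have := norm_setIntegral_le_of_norm_le_const (μ := volume) isCompact_V.measure_lt_top h
  rwa [volume_real_V, mul_comm] at this

theorem norm_iterated_integral_le {g : ℝ → ℝ → ℝ} {B : ℝ}
    (h : ∀ x ∈ Ioo (-1 : ℝ) 1, ∀ v ∈ V, ‖g x v‖ ≤ B) :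
    ‖∫ x in Ioo (-1 : ℝ) 1, ∫ v in V, g x v‖ ≤ 40 * B := by
  have := norm_setIntegral_le_of_norm_le_const (μ := volume) (s := Ioo (-1 : ℝ) 1)
    (f := fun x => ∫ v in V, g x v) (C := 20 * B) (by simp)
    (fun x hx => norm_setIntegral_V_le (h x hx))
  rw [Real.volume_real_Ioo_of_le (by norm_num)] at this
  linarith

theorem norm_setIntegral_time_le {T : ℝ} (hT : 0 ≤ T) {g : ℝ → ℝ} {B : ℝ}
    (h : ∀ t ∈ Ioo (0 : ℝ) T, ‖g t‖ ≤ B) : ‖∫ t in Ioo (0 : ℝ) T, g t‖ ≤ T * B := by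
  have := norm_setIntegral_le_of_norm_le_const (μ := volume) (s := Ioo (0 : ℝ) T) (by simp) h
  rwa [Real.volume_real_Ioo_of_le hT, sub_zero, mul_comm] at this

theorem norm_setIntegral_incoming_le {g : ℝ → ℝ} {B : ℝ} (hB : 0 ≤ B) {x : ℝ}
    (h : ∀ v ∈ incoming x, ‖g v‖ ≤ B) : ‖∫ v in incoming x, g v‖ ≤ 20 * B := by
  have hsub : incoming x ⊆ V := fun v hv => hv.1
  have := norm_setIntegral_le_of_norm_le_const (μ := volume)
    ((measure_mono hsub).trans_lt (isCompact_V.measure_lt_top (μ := volume))) h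
  refine this.trans ?_
  rw [mul_comm, ← volume_real_V]
  exact mul_le_mul_of_nonneg_right
    (measureReal_mono hsub (isCompact_V.measure_lt_top (μ := volume)).ne) hB

theorem abs_sq_norm_le {a B : ℝ} (h : |a| ≤ B) : ‖|a| ^ 2‖ ≤ B ^ 2 := by
  rw [norm_pow, Real.norm_eq_abs, abs_abs]
  gcongr

/-! ### The loss of an approximate solution -/

/-- `f` with first derivatives `ft, fx, fv` and second velocity derivative `fvv` solves the
equation in the interior, and `ft` is continuous. -/
structure StrongSolution (T σ β : ℝ) (f ft fx fv fvv : ℝ → ℝ → ℝ → ℝ) : Prop where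
  pde : ∀ t ∈ Ioo (0 : ℝ) T, ∀ x ∈ Ioo (-1 : ℝ) 1, ∀ v ∈ V,
    ft t x v + v * fx t x v = σ * fvv t x v + β * (f t x v + v * fv t x v)
  cont : ∀ t ∈ Icc (0 : ℝ) T,
    ContinuousOn (fun q : ℝ × ℝ => ft t q.1 q.2) (Icc (-1) 1 ×ˢ V)

/-- `F` and its derivatives are within `δ` of `f - r`, with `r` a function of time, and `H`, `Hv`
are within `δ` of the first two velocity derivatives of `f`. -/
structure NearSolution (T δ : ℝ) (r r' : ℝ → ℝ) (f ft fx fv fvv : ℝ → ℝ → ℝ → ℝ)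
    (F Ft Fx Fv H Hv : ℝ → ℝ → ℝ → ℝ) : Prop where
  cont : Continuous fun q : ℝ × ℝ × ℝ => F q.1 q.2.1 q.2.2
  cont_time : Continuous fun q : ℝ × ℝ × ℝ => Ft q.1 q.2.1 q.2.2
  deriv_time : ∀ t x v, HasDerivAt (fun s => F s x v) (Ft t x v) t
  deriv_space : ∀ t x v, HasDerivAt (fun y => F t y v) (Fx t x v) x
  deriv_velocity : ∀ t x v, HasDerivAt (fun u => F t x u) (Fv t x v) v
  deriv_aux : ∀ t x v, HasDerivAt (fun u => H t x u) (Hv t x v) v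
  near : ∀ t ∈ Icc (0 : ℝ) T, ∀ x ∈ Icc (-1 : ℝ) 1, ∀ v ∈ V,
    |F t x v - (f t x v - r t)| ≤ δ ∧ |Ft t x v - (ft t x v - r' t)| ≤ δ ∧
    |Fx t x v - fx t x v| ≤ δ ∧ |Fv t x v - fv t x v| ≤ δ ∧
    |H t x v - fv t x v| ≤ δ ∧ |Hv t x v - fvv t x v| ≤ δ

section estimates

variable {T σ β δ ρ : ℝ} {r r' : ℝ → ℝ} {f ft fx fv fvv F Ft Fx Fv H Hv : ℝ → ℝ → ℝ → ℝ}

/-- After subtracting the equation for `f`, the bound `|v| ≤ 10` gives `11δ` from transport, `σδ`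
from diffusion and `β(11δ + ρ)` from friction. The term `|r' t|` is kept apart because it is not
uniformly small. -/
theorem abs_residual_le (hσ : 0 ≤ σ) (hβ : 0 ≤ β)
    (hs : StrongSolution T σ β f ft fx fv fvv)
    (hn : NearSolution T δ r r' f ft fx fv fvv F Ft Fx Fv H Hv) (hr : ∀ t, |r t| ≤ ρ)
    {t x v : ℝ} (ht : t ∈ Ioo (0 : ℝ) T) (hx : x ∈ Ioo (-1 : ℝ) 1) (hv : v ∈ V) :
    |Ft t x v + v * Fx t x v - (σ * Hv t x v + β * (F t x v + v * Fv t x v))| ≤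
      (11 + σ + 11 * β) * (δ + ρ) + |r' t| := by
  obtain ⟨h0, h1, h2, h3, h4, h5⟩ := hn.near t (Ioo_subset_Icc_self ht) x
    (Ioo_subset_Icc_self hx) v hv
  have hp := hs.pde t ht x hx v hv
  have hv10 : |v| ≤ 10 := abs_le.2 hv
  have hδ : 0 ≤ δ := (abs_nonneg _).trans h0
  have hρ : 0 ≤ ρ := (abs_nonneg _).trans (hr t)
  have hrt := hr t
  have e2 : |v * (Fx t x v - fx t x v)| ≤ 10 * δ := by
    rw [abs_mul]; gcongr
  have e3 : |v * (Fv t x v - fv t x v)| ≤ 10 * δ := by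
    rw [abs_mul]; gcongr
  have e5 : |σ * (Hv t x v - fvv t x v)| ≤ σ * δ := by
    rw [abs_mul, abs_of_nonneg hσ]; gcongr
  have e6 : |β * ((F t x v - (f t x v - r t)) - r t + v * (Fv t x v - fv t x v))| ≤
      β * (11 * δ + ρ) := by
    rw [abs_mul, abs_of_nonneg hβ]
    gcongr
    calc _ ≤ |F t x v - (f t x v - r t)| + |r t| + |v * (Fv t x v - fv t x v)| :=
          (abs_add_le _ _).trans (by gcongr; exact abs_sub _ _)
      _ ≤ _ := by linarith
  have hid : Ft t x v + v * Fx t x v - (σ * Hv t x v + β * (F t x v + v * Fv t x v)) =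
      (Ft t x v - (ft t x v - r' t)) + v * (Fx t x v - fx t x v)
      - σ * (Hv t x v - fvv t x v)
      - β * ((F t x v - (f t x v - r t)) - r t + v * (Fv t x v - fv t x v)) - r' t := by
    linear_combination hp
  rw [hid]
  have a1 := abs_le.1 h1
  have a2 := abs_le.1 e2
  have a5 := abs_le.1 e5
  have a6 := abs_le.1 e6
  have a7 := le_abs_self (r' t)
  have a8 := neg_abs_le (r' t)
  have b1 : 0 ≤ σ * ρ := mul_nonneg hσ hρ
  have b2 : 0 ≤ β * ρ := mul_nonneg hβ hρ
  rw [abs_le]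
  constructor <;> nlinarith

theorem norm_lossGE_le (hT : 0 ≤ T) (hσ : 0 ≤ σ) (hβ : 0 ≤ β)
    (hs : StrongSolution T σ β f ft fx fv fvv)
    (hn : NearSolution T δ r r' f ft fx fv fvv F Ft Fx Fv H Hv) (hr : ∀ t, |r t| ≤ ρ)
    (hr' : Continuous r') :
    ‖lossGE T σ β F H‖ ≤
      40 * (∫ t in Ioo (0 : ℝ) T, ((11 + σ + 11 * β) * (δ + ρ) + |r' t|) ^ 2)
        + T * (40 * (2 * δ) ^ 2) := by
  unfold lossGE
  refine (norm_add_le _ _).trans (add_le_add ?_ ?_)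
  · rw [← integral_const_mul]
    refine norm_integral_le_of_norm_le ?_ ((ae_restrict_mem measurableSet_Ioo).mono
      fun t ht => norm_iterated_integral_le fun x hx v hv => ?_)
    · exact ((by fun_prop : Continuous fun t : ℝ =>
        40 * ((11 + σ + 11 * β) * (δ + ρ) + |r' t|) ^ 2).continuousOn.integrableOn_compact
        isCompact_Icc).mono_set Ioo_subset_Icc_self
    · refine abs_sq_norm_le ?_
      have hd : HasDerivAt (fun u => u * F t x u) (F t x v + v * Fv t x v) v :=
        ((hasDerivAt_id' v).mul (hn.deriv_velocity t x v)).congr_deriv (by ring)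
      rw [(hn.deriv_time t x v).deriv, (hn.deriv_space t x v).deriv, (hn.deriv_aux t x v).deriv,
        hd.deriv]
      exact abs_residual_le hσ hβ hs hn hr ht hx hv
  · refine norm_setIntegral_time_le hT fun t ht => norm_iterated_integral_le fun x hx v hv =>
      abs_sq_norm_le ?_
    obtain ⟨-, -, -, h3, h4, -⟩ := hn.near t (Ioo_subset_Icc_self ht) x
      (Ioo_subset_Icc_self hx) v hv
    rw [(hn.deriv_velocity t x v).deriv]
    have := abs_sub_le (H t x v) (fv t x v) (Fv t x v)
    rw [abs_sub_comm (fv t x v)] at this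
    linarith

theorem norm_lossIC_le (hT : 0 ≤ T) {f₀ : ℝ → ℝ → ℝ}
    (hf₀ : ∀ x ∈ Ioo (-1 : ℝ) 1, ∀ v ∈ V, f 0 x v = f₀ x v)
    (hn : NearSolution T δ r r' f ft fx fv fvv F Ft Fx Fv H Hv) (hr : ∀ t, |r t| ≤ ρ) :
    ‖lossIC f₀ F‖ ≤ 40 * (δ + ρ) ^ 2 := by
  refine norm_iterated_integral_le fun x hx v hv => abs_sq_norm_le ?_
  have h0 := (hn.near 0 ⟨le_rfl, hT⟩ x (Ioo_subset_Icc_self hx) v hv).1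
  rw [← hf₀ x hx v hv]
  have := abs_le.1 h0
  have := abs_le.1 (hr 0)
  rw [abs_le]; constructor <;> linarith

theorem norm_lossBC_le (hT : 0 ≤ T) {bc : BoundaryCondition}
    (hbc : ∀ t ∈ Ioo (0 : ℝ) T, ∀ x ∈ ({-1, 1} : Set ℝ), ∀ v ∈ incoming x,
      f t x v = bc.datum f t x v)
    (hn : NearSolution T δ r r' f ft fx fv fvv F Ft Fx Fv H Hv) (hr : ∀ t, |r t| ≤ ρ) :
    ‖lossBC T bc F‖ ≤ 2 * (T * (20 * (2 * (δ + ρ)) ^ 2)) := by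
  have hx : ∀ x ∈ ({-1, 1} : Finset ℝ), ‖∫ t in Ioo (0 : ℝ) T, ∫ v in incoming x,
      |F t x v - bc.datum F t x v| ^ 2‖ ≤ T * (20 * (2 * (δ + ρ)) ^ 2) := by
    intro x hx
    refine norm_setIntegral_time_le hT fun t ht => norm_setIntegral_incoming_le (by positivity)
      fun v hv => abs_sq_norm_le ?_
    have hx' : x ∈ ({-1, 1} : Set ℝ) := by simpa using hx
    have hxI : x ∈ Icc (-1 : ℝ) 1 := by
      rcases hx' with rfl | rfl <;> norm_num
    have hb := hbc t ht x hx' v hv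
    have h0 := (hn.near t (Ioo_subset_Icc_self ht) x hxI v hv.1).1
    have hv' : -v ∈ V := ⟨neg_le_neg hv.1.2, by have := hv.1.1; linarith⟩
    have h1 := (hn.near t (Ioo_subset_Icc_self ht) x hxI (-v) hv').1
    have a0 := abs_le.1 h0
    have a1 := abs_le.1 h1
    have a2 := abs_le.1 (hr t)
    cases bc with
    | inflow g =>
      simp only [BoundaryCondition.datum] at hb ⊢
      rw [← hb, abs_le]; constructor <;> linarith
    -- As `r` does not depend on `v`, it cancels between `v` and `-v`, so the correction does not
    -- disturb reflection.
    | specular =>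
      simp only [BoundaryCondition.datum] at hb ⊢
      rw [abs_le]; constructor <;> linarith
  refine (norm_sum_le_of_le _ hx).trans (le_of_eq ?_)
  rw [Finset.sum_const, Finset.card_pair (by norm_num), nsmul_eq_mul]
  norm_num

/-- The mass derivative of `f - r` at a grid time is `40 (c t - r' t)`, with 40 the area of `(-1,1)
× V`; replacing `f - r` by `F` adds at most `40 δ`. Only `c = r'` on the grid matters, not
conservation of mass by `f`. -/
theorem norm_lossMass_le {times : Finset ℝ} (htimes : ∀ t ∈ times, t ∈ Icc 0 T)
    (hs : StrongSolution T σ β f ft fx fv fvv)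
    (hn : NearSolution T δ r r' f ft fx fv fvv F Ft Fx Fv H Hv) {c : ℝ → ℝ}
    (hc : ∀ t ∈ times, ∫ x in Ioo (-1 : ℝ) 1, ∫ v in V, ft t x v = 40 * c t) :
    ‖lossMass times F‖ ≤ ∑ t ∈ times, (40 * δ + 40 * |c t - r' t|) ^ 2 := by
  refine norm_sum_le_of_le _ fun t ht => abs_sq_norm_le ?_
  have htT := htimes t ht
  rw [deriv_mass hn.cont hn.cont_time hn.deriv_time]
  set B : Set (ℝ × ℝ) := Ioo (-1 : ℝ) 1 ×ˢ V with hB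
  have hBs : B ⊆ Icc (-1) 1 ×ˢ V := prod_mono Ioo_subset_Icc_self subset_rfl
  have hcpt : IsCompact (Icc (-1 : ℝ) 1 ×ˢ V) := isCompact_Icc.prod isCompact_V
  have hi1 : IntegrableOn (fun q : ℝ × ℝ => ft t q.1 q.2) B :=
    ((hs.cont t htT).integrableOn_compact hcpt).mono_set hBs
  have hi2 : IntegrableOn (fun q : ℝ × ℝ => Ft t q.1 q.2) B :=
    ((hn.cont_time.comp (by fun_prop : Continuous fun q : ℝ × ℝ => (t, q.1, q.2))
      ).continuousOn.integrableOn_compact hcpt).mono_set hBs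
  have hBfin : volume B ≠ ⊤ := ((measure_mono hBs).trans_lt hcpt.measure_lt_top).ne
  have hBvol : volume.real B = 40 := by
    rw [hB, measureReal_def, Measure.volume_eq_prod, Measure.prod_prod, ENNReal.toReal_mul,
      ← measureReal_def, ← measureReal_def, volume_real_V, Real.volume_real_Ioo_of_le (by norm_num)]
    norm_num
  have p1 : ∫ q in B, ft t q.1 q.2 = 40 * c t := by
    rw [← hc t ht, hB, Measure.volume_eq_prod, setIntegral_prod _ hi1]
  have p2 : ∫ q in B, Ft t q.1 q.2 = ∫ x in Ioo (-1 : ℝ) 1, ∫ v in V, Ft t x v := by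
    rw [hB, Measure.volume_eq_prod, setIntegral_prod _ hi2]
  have hi3 : IntegrableOn (fun _ : ℝ × ℝ => r' t) B := integrableOn_const hBfin
  have p3 : ∫ q in B, (Ft t q.1 q.2 - (ft t q.1 q.2 - r' t)) =
      (∫ x in Ioo (-1 : ℝ) 1, ∫ v in V, Ft t x v) - (40 * c t - 40 * r' t) := by
    rw [integral_sub (μ := volume.restrict B) (g := fun q : ℝ × ℝ => ft t q.1 q.2 - r' t) hi2
      (hi1.sub hi3), integral_sub hi1 hi3, p1, p2, setIntegral_const, hBvol,
      smul_eq_mul]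
  have hle : ‖∫ q in B, (Ft t q.1 q.2 - (ft t q.1 q.2 - r' t))‖ ≤ δ * volume.real B :=
    norm_setIntegral_le_of_norm_le_const hBfin.lt_top
      fun q hq => (hn.near t htT q.1 (hBs hq).1 q.2 (hBs hq).2).2.1
  rw [p3, hBvol, Real.norm_eq_abs] at hle
  have a1 := abs_le.1 hle
  have a2 := le_abs_self (c t - r' t)
  have a3 := neg_abs_le (c t - r' t)
  rw [abs_le]; constructor <;> linarith

end estimates

/-! ### Correcting the mass at finitely many times -/

/-- A small function with derivative `1` at the origin, concentrated there as `N → ∞`. -/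
def spike (N s : ℝ) : ℝ := s / (1 + N ^ 2 * s ^ 2)

/-- The derivative of `spike`. -/
def spikeDeriv (N s : ℝ) : ℝ := (1 - N ^ 2 * s ^ 2) / (1 + N ^ 2 * s ^ 2) ^ 2

theorem hasDerivAt_spike (N s : ℝ) : HasDerivAt (spike N) (spikeDeriv N s) s := by
  have h0 : 1 + N ^ 2 * s ^ 2 ≠ 0 := by positivity
  have h1 : HasDerivAt (fun s : ℝ => 1 + N ^ 2 * s ^ 2) (N ^ 2 * (2 * s)) s := by
    simpa using ((hasDerivAt_pow 2 s).const_mul (N ^ 2)).const_add 1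
  refine ((hasDerivAt_id' s).div h1 h0).congr_deriv ?_
  unfold spikeDeriv
  congr 1
  ring

theorem continuous_spikeDeriv (N : ℝ) : Continuous (spikeDeriv N) := by
  unfold spikeDeriv
  exact Continuous.div (by fun_prop) (by fun_prop) fun s => by positivity

theorem abs_spike_le {N : ℝ} (hN : 0 < N) (s : ℝ) : |spike N s| ≤ 1 / N := by
  have h0 : 0 < 1 + N ^ 2 * s ^ 2 := by positivity
  rw [spike, abs_div, abs_of_pos h0, div_le_div_iff₀ h0 hN]
  -- The claim is `N|s| ≤ 1 + N²s²`, which follows from `(N|s| - 1)² ≥ 0`.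
  nlinarith [sq_nonneg (N * |s| - 1), sq_abs s, abs_nonneg s, mul_nonneg hN.le (abs_nonneg s)]

theorem abs_spikeDeriv_le (N s : ℝ) : |spikeDeriv N s| ≤ 1 / (1 + N ^ 2 * s ^ 2) := by
  have h0 : 0 < 1 + N ^ 2 * s ^ 2 := by positivity
  have h1 : 0 ≤ N ^ 2 * s ^ 2 := by positivity
  rw [spikeDeriv, abs_div, abs_of_pos (pow_pos h0 2), div_le_div_iff₀ (pow_pos h0 2) h0,
    pow_two (1 + N ^ 2 * s ^ 2), one_mul]
  exact mul_le_mul_of_nonneg_right (abs_le.2 ⟨by linarith, by linarith⟩) h0.le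

theorem abs_spikeDeriv_le_one (N s : ℝ) : |spikeDeriv N s| ≤ 1 := by
  have h1 : 0 ≤ N ^ 2 * s ^ 2 := by positivity
  refine (abs_spikeDeriv_le N s).trans ?_
  rw [div_le_one (by linarith)]
  linarith

theorem tendsto_spikeDeriv {s : ℝ} (hs : s ≠ 0) :
    Tendsto (fun n : ℕ => spikeDeriv (n + 1) s) atTop (𝓝 0) := by
  have hN : Tendsto (fun n : ℕ => (n : ℝ) + 1) atTop atTop :=
    tendsto_atTop_add_const_right _ _ tendsto_natCast_atTop_atTop
  have h1 : Tendsto (fun n : ℕ => 1 + ((n : ℝ) + 1) ^ 2 * s ^ 2) atTop atTop :=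
    tendsto_atTop_add_const_left _ _
      (((tendsto_pow_atTop two_ne_zero).comp hN).atTop_mul_const (by positivity))
  refine squeeze_zero_norm (fun n => abs_spikeDeriv_le _ s) ?_
  simp only [one_div]
  exact h1.inv_tendsto_atTop

/-- The time correction `∑ₖ cₖ spike(t - tₖ)`. Since nothing is prescribed at the artificial
boundary `v = ±10`, the mass of a solution may vary in time; subtracting the correction, which is
negligible in the other norms, makes the mass stationary at the grid times. -/
def correction (times : Finset ℝ) (c : ℝ → ℝ) (N t : ℝ) : ℝ :=
  ∑ k ∈ times, c k * spike N (t - k)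

/-- The derivative of `correction` in time. -/
def correctionDeriv (times : Finset ℝ) (c : ℝ → ℝ) (N t : ℝ) : ℝ :=
  ∑ k ∈ times, c k * spikeDeriv N (t - k)

section correction

variable (times : Finset ℝ) (c : ℝ → ℝ)

theorem hasDerivAt_correction (N t : ℝ) :
    HasDerivAt (correction times c N) (correctionDeriv times c N t) t :=
  HasDerivAt.fun_sum fun k _ => ((hasDerivAt_spike N (t - k)).comp_sub_const t k).const_mul (c k)

theorem continuous_correctionDeriv (N : ℝ) : Continuous (correctionDeriv times c N) :=
  continuous_finsetSum _ fun _ _ =>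
    continuous_const.mul ((continuous_spikeDeriv N).comp (continuous_id.sub continuous_const))

theorem abs_correction_le {N : ℝ} (hN : 0 < N) (t : ℝ) :
    |correction times c N t| ≤ (∑ k ∈ times, |c k|) * (1 / N) := by
  rw [Finset.sum_mul]
  refine Finset.abs_sum_le_sum_abs _ _ |>.trans (Finset.sum_le_sum fun k _ => ?_)
  rw [abs_mul]
  exact mul_le_mul_of_nonneg_left (abs_spike_le hN _) (abs_nonneg _)

theorem abs_correctionDeriv_le (N t : ℝ) :
    |correctionDeriv times c N t| ≤ ∑ k ∈ times, |c k| := by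
  refine Finset.abs_sum_le_sum_abs _ _ |>.trans (Finset.sum_le_sum fun k _ => ?_)
  rw [abs_mul]
  exact mul_le_of_le_one_right (abs_nonneg _) (abs_spikeDeriv_le_one _ _)

theorem tendsto_correctionDeriv (t : ℝ) :
    Tendsto (fun n : ℕ => correctionDeriv times c (n + 1) t) atTop
      (𝓝 (∑ k ∈ times, if t = k then c k else 0)) := by
  refine tendsto_finsetSum _ fun k _ => ?_
  split_ifs with h
  · simp [h, spikeDeriv]
  · simpa using (tendsto_spikeDeriv (sub_ne_zero.2 h)).const_mul (c k)

/-- Dominated convergence: `correctionDeriv` is bounded by the sum of the `|c k|` and tends to 0 off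
the grid, which is finite and hence null. -/
theorem tendsto_integral_correctionDeriv (T A : ℝ) {e : ℕ → ℝ} (he : Tendsto e atTop (𝓝 0)) :
    Tendsto (fun n : ℕ => ∫ t in Ioo (0 : ℝ) T,
      (A * e n + |correctionDeriv times c (n + 1) t|) ^ 2) atTop (𝓝 0) := by
  have hAe : Tendsto (fun n => A * e n) atTop (𝓝 0) := by simpa using he.const_mul A
  obtain ⟨M, hM⟩ := hAe.norm.bddAbove_range
  have hlim := tendsto_integral_of_dominated_convergence (μ := volume.restrict (Ioo (0 : ℝ) T))
    (F := fun (n : ℕ) t => (A * e n + |correctionDeriv times c (n + 1) t|) ^ 2)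
    (f := fun _ => 0) (fun _ => (M + ∑ k ∈ times, |c k|) ^ 2)
    (fun n => ?_) ?_ (fun n => Eventually.of_forall fun t => ?_) ?_
  · simpa using hlim
  · have := continuous_correctionDeriv times c (n + 1)
    exact Continuous.aestronglyMeasurable (by fun_prop)
  · exact integrableOn_const (by simp)
  · rw [norm_pow]
    gcongr
    refine (norm_add_le _ _).trans (add_le_add (hM ⟨n, rfl⟩) ?_)
    rw [norm_abs_eq_norm]
    exact abs_correctionDeriv_le times c _ t
  · refine ae_restrict_of_ae ?_
    filter_upwards [compl_mem_ae_iff.2 (times.finite_toSet.measure_zero volume)] with t ht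
    have h0 : ∑ k ∈ times, (if t = k then c k else 0) = 0 :=
      Finset.sum_eq_zero fun k hk => if_neg fun h => ht (by simpa [h] using hk)
    have := tendsto_correctionDeriv times c t
    rw [h0] at this
    simpa using (hAe.add this.abs).pow 2

theorem tendsto_correctionDeriv_of_mem {t : ℝ} (ht : t ∈ times) :
    Tendsto (fun n : ℕ => correctionDeriv times c (n + 1) t) atTop (𝓝 (c t)) := by
  simpa [ht] using tendsto_correctionDeriv times c t

end correction

/-! ### Solutions of class `(1, 1, 2)` -/

theorem isCompact_K (T : ℝ) : IsCompact (K T) := by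
  have : K T = Icc ![0, -1, -10] ![T, 1, 10] := by
    ext z
    simp [K, V, Pi.le_def, Fin.forall_fin_succ]
    tauto
  rw [this]
  exact isCompact_Icc

section coordinates

variable {P : (Fin 3 → ℝ) → ℝ} {p t x v : ℝ}

theorem hasDerivAt_time_of_hasLineDerivAt
    (h : HasLineDerivAt ℝ P p ![t, x, v] (Pi.single 0 1)) :
    HasDerivAt (fun s => P ![s, x, v]) p t := by
  have h1 : HasDerivAt (fun s => P (![t, x, v] + s • Pi.single 0 1)) p (t - t) := by
    rw [sub_self]; exact h
  refine (h1.comp_sub_const t t).congr_of_eventuallyEq (Eventually.of_forall fun s => ?_)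
  refine congrArg P (?_ : ![s, x, v] = ![t, x, v] + (s - t) • Pi.single 0 1)
  ext i; fin_cases i <;> simp

theorem hasDerivAt_space_of_hasLineDerivAt
    (h : HasLineDerivAt ℝ P p ![t, x, v] (Pi.single 1 1)) :
    HasDerivAt (fun y => P ![t, y, v]) p x := by
  have h1 : HasDerivAt (fun s => P (![t, x, v] + s • Pi.single 1 1)) p (x - x) := by
    rw [sub_self]; exact h
  refine (h1.comp_sub_const x x).congr_of_eventuallyEq (Eventually.of_forall fun s => ?_)
  refine congrArg P (?_ : ![t, s, v] = ![t, x, v] + (s - x) • Pi.single 1 1)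
  ext i; fin_cases i <;> simp

theorem hasDerivAt_velocity_of_hasLineDerivAt
    (h : HasLineDerivAt ℝ P p ![t, x, v] (Pi.single 2 1)) :
    HasDerivAt (fun u => P ![t, x, u]) p v := by
  have h1 : HasDerivAt (fun s => P (![t, x, v] + s • Pi.single 2 1)) p (v - v) := by
    rw [sub_self]; exact h
  refine (h1.comp_sub_const v v).congr_of_eventuallyEq (Eventually.of_forall fun s => ?_)
  refine congrArg P (?_ : ![t, x, s] = ![t, x, v] + (s - v) • Pi.single 2 1)
  ext i; fin_cases i <;> simp

/-- No differentiability is assumed, so the identity holds at every velocity and may be used under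
the outer `deriv` of the equation. -/
theorem deriv_velocity_eq_partialD (P : (Fin 3 → ℝ) → ℝ) (t x v : ℝ) :
    deriv (fun u => P ![t, x, u]) v = partialD 2 P ![t, x, v] := by
  have h : (fun s : ℝ => P (![t, x, v] + s • Pi.single 2 1)) = fun s => P ![t, x, v + s] := by
    funext s
    congr 1
    ext i; fin_cases i <;> simp
  rw [partialD, lineDeriv, h, deriv_comp_const_add (fun u => P ![t, x, u]), add_zero]

end coordinates

/-- The function of `z = (t, x, v)` that belongs to `f`. -/
abbrev unc (f : ℝ → ℝ → ℝ → ℝ) : (Fin 3 → ℝ) → ℝ := fun z => f (z 0) (z 1) (z 2)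

theorem mem_K {T t x v : ℝ} (ht : t ∈ Icc 0 T) (hx : x ∈ Icc (-1 : ℝ) 1) (hv : v ∈ V) :
    ![t, x, v] ∈ K T := ⟨ht, hx, hv⟩

section regularity

variable {f : ℝ → ℝ → ℝ → ℝ} {Ω : Set (Fin 3 → ℝ)}

theorem ContDiffMulti.hasLineDerivAt_partialD (h : ContDiffMulti ![1, 1, 2] (unc f) Ω) (i : Fin 3)
    {z : Fin 3 → ℝ} (hz : z ∈ Ω) :
    HasLineDerivAt ℝ (unc f) (partialD i (unc f) z) z (Pi.single i 1) :=
  (h.exists_deriv i [] (by decide +revert) z hz).hasLineDerivAt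

theorem ContDiffMulti.hasLineDerivAt_partialD_two (h : ContDiffMulti ![1, 1, 2] (unc f) Ω)
    {z : Fin 3 → ℝ} (hz : z ∈ Ω) :
    HasLineDerivAt ℝ (partialD 2 (unc f)) (partialD 2 (partialD 2 (unc f)) z) z (Pi.single 2 1) :=
  (h.exists_deriv 2 [2] (by decide) z hz).hasLineDerivAt

theorem ContDiffMulti.continuousOn_partialD (h : ContDiffMulti ![1, 1, 2] (unc f) Ω) (i : Fin 3) :
    ContinuousOn (partialD i (unc f)) Ω :=
  h.continuous_deriv [i] (by decide +revert)

theorem ContDiffMulti.continuousOn_partialD_two (h : ContDiffMulti ![1, 1, 2] (unc f) Ω) :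
    ContinuousOn (partialD 2 (partialD 2 (unc f))) Ω :=
  h.continuous_deriv [2, 2] (by decide)

theorem strongSolution_of_isSolution {T σ β : ℝ} {f₀ : ℝ → ℝ → ℝ} {bc : BoundaryCondition}
    (hf : IsSolution T σ β f₀ bc f) (h : ContDiffMulti ![1, 1, 2] (unc f) Ω) (hΩ : K T ⊆ Ω) :
    StrongSolution T σ β f (fun t x v => partialD 0 (unc f) ![t, x, v])
      (fun t x v => partialD 1 (unc f) ![t, x, v]) (fun t x v => partialD 2 (unc f) ![t, x, v])
      (fun t x v => partialD 2 (partialD 2 (unc f)) ![t, x, v]) where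
  pde t ht x hx v hv := by
    have hz := hΩ (mem_K (Ioo_subset_Icc_self ht) (Ioo_subset_Icc_self hx) hv)
    have d0 : HasDerivAt (fun s => f s x v) _ t :=
      hasDerivAt_time_of_hasLineDerivAt (h.hasLineDerivAt_partialD 0 hz)
    have d1 : HasDerivAt (fun y => f t y v) _ x :=
      hasDerivAt_space_of_hasLineDerivAt (h.hasLineDerivAt_partialD 1 hz)
    have d2 : HasDerivAt (fun u => f t x u) _ v :=
      hasDerivAt_velocity_of_hasLineDerivAt (h.hasLineDerivAt_partialD 2 hz)
    have d22 := hasDerivAt_velocity_of_hasLineDerivAt (h.hasLineDerivAt_partialD_two hz)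
    have he : ∀ u, deriv (fun u' => f t x u') u = partialD 2 (unc f) ![t, x, u] :=
      deriv_velocity_eq_partialD (unc f) t x
    have heq := hf.equation t ht x hx v hv
    simp only [he] at heq
    rw [d0.deriv, d1.deriv, ((d22.const_mul σ).fun_add
      (((hasDerivAt_id' v).const_mul β).fun_mul d2)).deriv] at heq
    rw [heq]
    ring
  cont t ht := (h.continuousOn_partialD 0).comp (by fun_prop) fun q hq =>
    hΩ (mem_K ht hq.1 hq.2)

end regularity

/-! ### Networks near a solution -/

/-- The same parameters serve both choices of `H`, so a single sequence handles both limits. The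
correction enters only the value and the time derivative, leaving the targets for `H` unchanged. -/
theorem exists_params_nearSolution {T : ℝ} {f : ℝ → ℝ → ℝ → ℝ} {Ω : Set (Fin 3 → ℝ)}
    (hΩ : IsOpen Ω) (hKΩ : K T ⊆ Ω) (h : ContDiffMulti ![1, 1, 2] (unc f) Ω)
    {act : ℝ → ℝ} (hact : ContDiff ℝ 2 act)
    (hnp : ¬ ∃ p : Polynomial ℝ, ∀ y, act y = p.eval y)
    {r r' : ℝ → ℝ} (hr : ∀ t, HasDerivAt r (r' t) t) (hr' : Continuous r')
    {δ : ℝ} (hδ : 0 < δ) :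
    ∃ (m : ℕ) (p : Params m) (Ft Fx Fv Hv Lv : ℝ → ℝ → ℝ → ℝ),
      NearSolution T δ r r' f (fun t x v => partialD 0 (unc f) ![t, x, v])
        (fun t x v => partialD 1 (unc f) ![t, x, v]) (fun t x v => partialD 2 (unc f) ![t, x, v])
        (fun t x v => partialD 2 (partialD 2 (unc f)) ![t, x, v])
        (p.fnn act) Ft Fx Fv (p.hnn act) Hv ∧
      NearSolution T δ r r' f (fun t x v => partialD 0 (unc f) ![t, x, v])
        (fun t x v => partialD 1 (unc f) ![t, x, v]) (fun t x v => partialD 2 (unc f) ![t, x, v])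
        (fun t x v => partialD 2 (partialD 2 (unc f)) ![t, x, v])
        (p.fnn act) Ft Fx Fv (fun t x v => deriv (fun u => p.fnn act t x u) v) Lv := by
  have hd1 : ContDiff ℝ 1 (deriv act) :=
    (contDiff_succ_iff_deriv.1 (by rw [one_add_one_eq_two]; exact hact :
      ContDiff ℝ (1 + 1) act)).2.2
  let a₀ : C(ℝ, ℝ) := ⟨act, hact.continuous⟩
  let a₁ : C(ℝ, ℝ) := ⟨deriv act, hd1.continuous⟩
  let a₂ : C(ℝ, ℝ) := ⟨deriv (deriv act), hd1.continuous_deriv le_rfl⟩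
  have h₁ : ∀ x, HasDerivAt a₀ (a₁ x) x := fun x =>
    (hact.differentiable (by simp) x).hasDerivAt
  have h₂ : ∀ x, HasDerivAt a₁ (a₂ x) x := fun x =>
    (hd1.differentiable (by simp) x).hasDerivAt
  let φ := EuclideanSpace.equiv (Fin 3) ℝ
  have hφ : Continuous φ := φ.continuous
  have hline : ∀ {P : (Fin 3 → ℝ) → ℝ} {q : ℝ} {z : E3} {i : Fin 3},
      HasLineDerivAt ℝ P q (φ z) (Pi.single i 1) →
      HasLineDerivAt ℝ (fun y => P (φ y)) q z (EuclideanSpace.single i 1) := by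
    intro P q z i hP
    have he : ∀ s : ℝ, φ (z + s • EuclideanSpace.single i 1) = φ z + s • Pi.single i 1 :=
      fun s => by rw [map_add, map_smul]; rfl
    simpa only [HasLineDerivAt, he] using hP
  have hrc : Continuous r := continuous_iff_continuousAt.2 fun t => (hr t).continuousAt
  have hrline : ∀ (i : Fin 3) (z : E3), HasLineDerivAt ℝ (fun y : E3 => r (y 0))
      (if i = 0 then r' (z 0) else 0) z (EuclideanSpace.single i 1) := by
    intro i z
    have hl : HasLineDerivAt ℝ (fun y : E3 => y 0) ((EuclideanSpace.single i (1 : ℝ) : E3) 0) z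
        (EuclideanSpace.single i 1) :=
      (EuclideanSpace.proj (𝕜 := ℝ) (0 : Fin 3)).hasFDerivAt.hasLineDerivAt _
    have := HasDerivAt.comp (0 : ℝ) (h₂ := r) (h := fun s : ℝ =>
      (z + s • EuclideanSpace.single i (1 : ℝ) : E3) 0) (by simpa using hr (z 0)) hl
    refine HasDerivAt.congr_deriv this ?_
    by_cases hi : i = 0
    · simp [hi]
    · simp [hi, Ne.symm hi]
  obtain ⟨n, c, w, θ, k, d, y, η, hnear⟩ := exists_ridgeSum_pair_near (S := φ ⁻¹' K T)
    (Ω := φ ⁻¹' Ω) (φ.toHomeomorph.isCompact_preimage.2 (isCompact_K T)) (hΩ.preimage hφ)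
    (preimage_mono hKΩ) h₁ h₂ hnp
    (G := fun z => unc f (φ z) - r (z 0))
    (D := fun i z => partialD i (unc f) (φ z) - if i = 0 then r' (z 0) else 0)
    (D₂ := fun z => partialD 2 (partialD 2 (unc f)) (φ z))
    (((h.continuous_deriv [] (by simp)).comp hφ.continuousOn fun z hz => hz).sub
      (by fun_prop))
    (fun i => ((h.continuousOn_partialD i).comp hφ.continuousOn fun z hz => hz).sub
      (by split_ifs <;> fun_prop))
    (h.continuousOn_partialD_two.comp hφ.continuousOn fun z hz => hz)
    (fun i z hz => HasDerivAt.fun_sub (hline (h.hasLineDerivAt_partialD i hz)) (hrline i z))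
    (fun z hz => by simpa using hline (h.hasLineDerivAt_partialD_two hz)) hδ
  obtain ⟨p, hp, hp'⟩ := exists_params_of_ridgeSum act c w θ d y η
  have hv : ∀ t x v, HasDerivAt (fun u => ridgeSum act c w θ t x u)
      (ridgeSum a₁ (fun j => c j * w j 2) w θ t x v) v := hasDerivAt_ridgeSum_velocity h₁ c w θ
  have hnear' : ∀ t ∈ Icc (0 : ℝ) T, ∀ x ∈ Icc (-1 : ℝ) 1, ∀ v ∈ V, _ :=
    fun t ht x hx v hv => hnear (φ.symm ![t, x, v]) (by simpa using mem_K ht hx hv)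
  refine ⟨n + k, p, ridgeSum a₁ (fun j => c j * w j 0) w θ,
    ridgeSum a₁ (fun j => c j * w j 1) w θ, ridgeSum a₁ (fun j => c j * w j 2) w θ,
    ridgeSum a₁ (fun j => d j * y j 2) y η, ridgeSum a₂ (fun j => c j * w j 2 * w j 2) w θ, ?_, ?_⟩
  · rw [hp, hp']
    refine ⟨continuous_ridgeSum a₀.continuous c w θ, continuous_ridgeSum a₁.continuous _ w θ,
      hasDerivAt_ridgeSum_time h₁ c w θ, hasDerivAt_ridgeSum_space h₁ c w θ, hv,
      hasDerivAt_ridgeSum_velocity h₁ d y η, fun t ht x hx v hv => ?_⟩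
    obtain ⟨n0, n1, n2, n3, n4⟩ := hnear' t ht x hx v hv
    have n11 := n1 1
    have n12 := n1 2
    simp only [Fin.reduceEq, if_false, sub_zero] at n11 n12 n3
    exact ⟨n0, n1 0, n11, n12, n3, n4⟩
  · rw [hp, show (fun t x v => deriv (fun u => ridgeSum act c w θ t x u) v) =
      ridgeSum a₁ (fun j => c j * w j 2) w θ from
      funext fun t => funext fun x => funext fun v => (hv t x v).deriv]
    refine ⟨continuous_ridgeSum a₀.continuous c w θ, continuous_ridgeSum a₁.continuous _ w θ,
      hasDerivAt_ridgeSum_time h₁ c w θ, hasDerivAt_ridgeSum_space h₁ c w θ, hv,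
      hasDerivAt_ridgeSum_velocity h₂ _ w θ, fun t ht x hx v hv => ?_⟩
    obtain ⟨n0, n1, n2, n3, n4⟩ := hnear' t ht x hx v hv
    have n11 := n1 1
    have n12 := n1 2
    simp only [Fin.reduceEq, if_false, sub_zero] at n11 n12
    exact ⟨n0, n1 0, n11, n12, n12, n2⟩

/-- The bound for the total loss of a pair that is `δ`-near to `f - r`, where `|r| ≤ e - δ`. -/
def lossBound (T σ β : ℝ) (times : Finset ℝ) (c r' : ℝ → ℝ) (δ e : ℝ) : ℝ :=
  40 * (∫ t in Ioo (0 : ℝ) T, ((11 + σ + 11 * β) * e + |r' t|) ^ 2) + T * (40 * (2 * δ) ^ 2)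
    + 40 * e ^ 2 + 2 * (T * (20 * (2 * e) ^ 2)) + ∑ t ∈ times, (40 * δ + 40 * |c t - r' t|) ^ 2

theorem norm_lossTotal_le {T σ β δ ρ : ℝ} (hT : 0 ≤ T) (hσ : 0 ≤ σ) (hβ : 0 ≤ β)
    {times : Finset ℝ} (htimes : ∀ t ∈ times, t ∈ Icc 0 T) {f₀ : ℝ → ℝ → ℝ}
    {bc : BoundaryCondition} {f ft fx fv fvv F Ft Fx Fv H Hv : ℝ → ℝ → ℝ → ℝ} {r r' c : ℝ → ℝ}
    (hf : IsSolution T σ β f₀ bc f) (hs : StrongSolution T σ β f ft fx fv fvv)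
    (hn : NearSolution T δ r r' f ft fx fv fvv F Ft Fx Fv H Hv) (hr : ∀ t, |r t| ≤ ρ)
    (hr' : Continuous r')
    (hc : ∀ t ∈ times, ∫ x in Ioo (-1 : ℝ) 1, ∫ v in V, ft t x v = 40 * c t) :
    ‖lossTotal T σ β times f₀ bc F H‖ ≤ lossBound T σ β times c r' δ (δ + ρ) := by
  unfold lossTotal lossBound
  refine (norm_add_le _ _).trans (add_le_add ((norm_add_le _ _).trans (add_le_add
    ((norm_add_le _ _).trans (add_le_add (norm_lossGE_le hT hσ hβ hs hn hr hr')
      (norm_lossIC_le hT hf.initial hn hr))) (norm_lossBC_le hT hf.boundary hn hr))) ?_)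
  cases bc with
  | inflow g =>
    rw [norm_zero]
    -- For inflow the mass part of the common bound is merely a nonnegative surplus.
    exact Finset.sum_nonneg fun t _ => sq_nonneg _
  | specular => exact norm_lossMass_le htimes hs hn hc

theorem tendsto_lossBound (T σ β : ℝ) (times : Finset ℝ) (c : ℝ → ℝ) {δ e : ℕ → ℝ}
    (hδ : Tendsto δ atTop (𝓝 0)) (he : Tendsto e atTop (𝓝 0)) :
    Tendsto (fun n : ℕ => lossBound T σ β times c (correctionDeriv times c (n + 1)) (δ n) (e n))
      atTop (𝓝 0) := by
  have h1 := (tendsto_integral_correctionDeriv times c T (11 + σ + 11 * β) he).const_mul 40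
  have h2 := (((hδ.const_mul 2).pow 2).const_mul 40).const_mul T
  have h3 := (he.pow 2).const_mul 40
  have h4 := ((((he.const_mul 2).pow 2).const_mul 20).const_mul T).const_mul 2
  have h5 : Tendsto (fun n : ℕ => ∑ t ∈ times,
      (40 * δ n + 40 * |c t - correctionDeriv times c (n + 1) t|) ^ 2) atTop
      (𝓝 (∑ t ∈ times, 0)) := by
    refine tendsto_finsetSum _ fun t ht => ?_
    have := ((hδ.const_mul 40).add (((tendsto_correctionDeriv_of_mem times c ht).const_sub
      (c t)).abs.const_mul 40)).pow 2
    simpa using this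
  simpa [lossBound] using (((h1.add h2).add h3).add h4).add h5

end KineticFP

end

theorem theorem3p3
    (T σ β : ℝ) (hT : 0 < T) (hσ : 0 < σ) (hβ : 0 ≤ β)
    (times : Finset ℝ) (htimes : ∀ t ∈ times, t ∈ Set.Icc 0 T)
    (f₀ : ℝ → ℝ → ℝ) (bc : KineticFP.BoundaryCondition) (f : ℝ → ℝ → ℝ → ℝ)
    (hf : KineticFP.IsSolution T σ β f₀ bc f)
    (hf_reg : KineticFP.ContDiffHat ![1, 1, 2] (fun z => f (z 0) (z 1) (z 2)) (KineticFP.K T))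
    (act : ℝ → ℝ) (hact : ContDiff ℝ 2 act)
    (hact_np : ¬ ∃ p : Polynomial ℝ, ∀ y, act y = p.eval y) :
    ∃ (m : ℕ → ℕ) (p : ∀ j, KineticFP.Params (m j)),
      Filter.Tendsto (fun j => KineticFP.lossTotal T σ β times f₀ bc
        ((p j).fnn act) ((p j).hnn act)) Filter.atTop (nhds 0) ∧
      Filter.Tendsto (fun j => KineticFP.lossTotal T σ β times f₀ bc
        ((p j).fnn act) (fun t x v => deriv (fun u => (p j).fnn act t x u) v))
        Filter.atTop (nhds 0) := by
  obtain ⟨Ω, hΩ, hKΩ, h⟩ := hf_reg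
  have hs := KineticFP.strongSolution_of_isSolution hf h hKΩ
  -- The mean of `∂ₜf` over `(-1,1) × V`, whose area is 40: subtracting a function of time with this
  -- slope makes the mass stationary.
  let c : ℝ → ℝ := fun t => (∫ x in Set.Ioo (-1 : ℝ) 1, ∫ v in KineticFP.V,
    KineticFP.partialD 0 (KineticFP.unc f) ![t, x, v]) / 40
  have hδ : Filter.Tendsto (fun n : ℕ => 1 / ((n : ℝ) + 1)) Filter.atTop (nhds 0) :=
    tendsto_one_div_add_atTop_nhds_zero_nat
  have hN : ∀ n : ℕ, (0 : ℝ) < n + 1 := fun n => by positivity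
  -- Spike sharpness `n + 1` and network accuracy `1 / (n + 1)` are coupled; for each `n` the
  -- correction is a fixed C¹ function, so the density result applies to `f` minus it.
  choose m p Ft Fx Fv Hv Lv hH hL using fun n : ℕ =>
    KineticFP.exists_params_nearSolution hΩ hKΩ h hact hact_np
      (KineticFP.hasDerivAt_correction times c (n + 1))
      (KineticFP.continuous_correctionDeriv times c (n + 1)) (one_div_pos.2 (hN n))
  have hlim := KineticFP.tendsto_lossBound T σ β times c hδ
    (e := fun n : ℕ => 1 / ((n : ℝ) + 1) + (∑ k ∈ times, |c k|) * (1 / ((n : ℝ) + 1)))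
    (by simpa using hδ.add (hδ.const_mul (∑ k ∈ times, |c k|)))
  have hc : ∀ t ∈ times, _ = 40 * c t := fun t _ => (mul_div_cancel₀ _ (by norm_num)).symm
  exact ⟨m, p,
    squeeze_zero_norm (fun n => KineticFP.norm_lossTotal_le hT.le hσ.le hβ htimes hf hs (hH n)
      (KineticFP.abs_correction_le times c (hN n))
      (KineticFP.continuous_correctionDeriv times c _) hc) hlim,
    squeeze_zero_norm (fun n => KineticFP.norm_lossTotal_le hT.le hσ.le hβ htimes hf hs (hL n)
      (KineticFP.abs_correction_le times c (hN n))
      (KineticFP.continuous_correctionDeriv times c _) hc) hlim⟩
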